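/- Let $k$ be a field and let $\Lambda=\Lambda_0\oplus\Lambda_1\oplus\cdots$ be a standardly graded $k$-algebra, i.e. $\Lambda_0\cong k^r$ as a $k$-algebra for some $r\ge 1$, $\dim_k\Lambda_i<\infty$ and $\Lambda_i\Lambda_j=\Lambda_{i+j}$ for all $i,j\ge 0$. Put $J=\bigoplus_{i\ge 1}\Lambda_i$. Let $\mathrm{Gr}(\Lambda)$ be the category of $\mathbb Z$-graded left $\Lambda$-modules and degree-preserving $\Lambda$-homomorphisms, let $M[n]$ denote the shift $M[n]_i=M_{i-n}$, and let $\Lambda_0=\Lambda/J$ be the trivial graded module, concentrated in degree $0$. A graded module $Q$ is generated in degrees in $I\subseteq\mathbb Z$ if $Q=\Lambda\bigl(\bigoplus_{j\in I}Q_j\bigr)$. Let $d\ge 2$ be an integer. For $n\ge 0$ put $\delta(2n)=nd$, $\delta(2n+1)=nd+1$, $\Delta(2n)=\{nd\}$ and $\Delta(2n+1)=\{nd+1,\dots,nd+d-1\}$. A graded $\Lambda$-module $M$ is $d$-Koszul (respectively generalized $d$-Koszul) if it has a graded projective resolution $\cdots\to Q^1\to Q^0\to M\to 0$ in which every $Q^i$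 is finitely generated and is generated in degree $\delta(i)$ (respectively in degrees in $\Delta(i)$). The algebra $\Lambda$ is $d$-Koszul if the module $\Lambda_0$ is $d$-Koszul. **Theorem 2.6.** Let $\Lambda$ be a $d$-Koszul algebra and $M$ a generalized $d$-Koszul $\Lambda$-module. Then: (i) $(J^iM)[-i]$ is generalized $d$-Koszul for each $i\ge 1$. (ii) For each $n\ge 1$ there are isomorphisms of $k$-vector spaces $$\mathrm{Ext}^{2n-1}_{\mathrm{Gr}(\Lambda)}(JM,\Lambda_0[nd])\cong\mathrm{Ext}^{2n-1}_{\mathrm{Gr}(\Lambda)}(J^2M,\Lambda_0[nd])\cong\cdots\cong\mathrm{Ext}^{2n-1}_{\mathrm{Gr}(\Lambda)}(J^{d-1}M,\Lambda_0[nd]).$$ -/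

import Mathlib

open CategoryTheory CategoryTheory.Limits

universe w u

/-! ### Standardly graded algebras -/

/-- A positively graded `k`-algebra `Λ = Λ₀ ⊕ Λ₁ ⊕ ⋯` is standardly graded if `Λ₀ ≅ k^r` as a
`k`-algebra for some `r ≥ 1`, each `Λ_i` is finite-dimensional, and `Λ_i Λ_j = Λ_{i+j}`. -/
structure IsStandardlyGraded {k : Type w} [Field k] {A : Type u} [Ring A] [Algebra k A]
    (𝒜 : ℕ → Submodule k A) [GradedAlgebra 𝒜] : Prop where
  degree_zero : ∃ r : ℕ, 1 ≤ r ∧ Nonempty ((𝒜 0) ≃ₐ[k] (Fin r → k))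
  finite : ∀ i, Module.Finite k (𝒜 i)
  mul_eq : ∀ i j, 𝒜 i * 𝒜 j = 𝒜 (i + j)

/-! ### Gradings by `ℤ` of a vector space -/

section Grading

variable {k : Type w} [Field k] {V : Type u} [AddCommGroup V] [Module k V]

/-- A family of subspaces which spans and admits projections is a direct sum decomposition. -/
theorem isInternal_of_proj (ℳ : ℤ → Submodule k V) (p : ℤ → V →ₗ[k] V)
    (h1 : ∀ i, ∀ x ∈ ℳ i, p i x = x) (h2 : ∀ i j, i ≠ j → ∀ x ∈ ℳ i, p j x = 0)
    (hs : iSup ℳ = ⊤) : DirectSum.IsInternal ℳ := by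
  refine DirectSum.isInternal_submodule_of_iSupIndep_of_iSup_eq_top (fun i => ?_) hs
  rw [Submodule.disjoint_def]
  intro x hx hx'
  have : (⨆ j, ⨆ (_ : j ≠ i), ℳ j) ≤ LinearMap.ker (p i) :=
    iSup₂_le fun j hj y hy => h2 j i hj y hy
  rw [← h1 i x hx]
  exact this hx'

/-- The projection onto the `i`-th component of a direct sum decomposition. -/
noncomputable def gradedProj {ℳ : ℤ → Submodule k V} (h : DirectSum.IsInternal ℳ) (i : ℤ) :
    V →ₗ[k] V :=
  (ℳ i).subtype ∘ₗ DirectSum.component k ℤ (fun i => ℳ i) i ∘ₗ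
    (LinearEquiv.ofBijective (DirectSum.coeLinearMap ℳ) h).symm.toLinearMap

variable {ℳ : ℤ → Submodule k V} (h : DirectSum.IsInternal ℳ)

theorem gradedProj_mem (i : ℤ) (x : V) : gradedProj h i x ∈ ℳ i :=
  Submodule.coe_mem _

theorem gradedProj_same {i : ℤ} {x : V} (hx : x ∈ ℳ i) : gradedProj h i x = x := by
  exact congrArg Subtype.val (h.ofBijective_coeLinearMap_of_mem hx)

theorem gradedProj_ne {i j : ℤ} (hij : i ≠ j) {x : V} (hx : x ∈ ℳ i) :
    gradedProj h j x = 0 := by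
  exact congrArg Subtype.val (h.ofBijective_coeLinearMap_of_mem_ne hij hx)

theorem graded_induction (h : DirectSum.IsInternal ℳ) {P : V → Prop} (h0 : P 0) (hadd : ∀ x y, P x → P y → P (x + y))
    (hm : ∀ i, ∀ x ∈ ℳ i, P x) (x : V) : P x := by
  have hx : x ∈ iSup ℳ := by rw [h.submodule_iSup_eq_top]; trivial
  exact Submodule.iSup_induction ℳ (motive := P) hx hm h0 hadd

/-- Every element lies in the sum of its homogeneous components. -/
theorem mem_span_gradedProj (x : V) :
    x ∈ Submodule.span k (Set.range fun i => gradedProj h i x) := by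
  classical
  set y := (LinearEquiv.ofBijective (DirectSum.coeLinearMap ℳ) h).symm x with hy
  have hx : x = ∑ i ∈ DFinsupp.support y, (y i : V) := by
    have : DirectSum.coeLinearMap ℳ y = x :=
      (LinearEquiv.ofBijective (DirectSum.coeLinearMap ℳ) h).apply_symm_apply x
    rw [← this, DirectSum.coeLinearMap_eq_dfinsuppSum]
    rfl
  have : ∑ i ∈ DFinsupp.support y, (y i : V) ∈
      Submodule.span k (Set.range fun i => gradedProj h i x) :=
    Submodule.sum_mem _ fun i _ => Submodule.subset_span ⟨i, rfl⟩
  rwa [← hx] at this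

end Grading

/-! ### The category `Gr(Λ)` of graded left modules -/

/-- A graded left `Λ`-module: a `Λ`-module `M` together with a decomposition of `k`-spaces
`M = ⨁_{i ∈ ℤ} M_i` such that `Λ_i M_j ⊆ M_{i+j}`. -/
structure GrMod {k : Type w} [Field k] {A : Type u} [Ring A] [Algebra k A]
    (𝒜 : ℕ → Submodule k A) where
  carrier : Type u
  [addCommGroup : AddCommGroup carrier]
  [module : Module A carrier]
  [moduleBase : Module k carrier]
  [isScalarTower : IsScalarTower k A carrier]
  /-- the homogeneous components -/
  gr : ℤ → Submodule k carrier
  isInternal : DirectSum.IsInternal gr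
  smul_mem : ∀ {i : ℕ} {j : ℤ} {a : A} {m : carrier},
    a ∈ 𝒜 i → m ∈ gr j → a • m ∈ gr (i + j)

attribute [instance] GrMod.addCommGroup GrMod.module GrMod.moduleBase GrMod.isScalarTower

namespace GrMod

variable {k : Type w} [Field k] {A : Type u} [Ring A] [Algebra k A] {𝒜 : ℕ → Submodule k A}

instance : CoeSort (GrMod 𝒜) (Type u) := ⟨GrMod.carrier⟩

/-- The projection of a graded module onto its `i`-th component. -/
noncomputable def proj (M : GrMod 𝒜) (i : ℤ) : M →ₗ[k] M := gradedProj M.isInternal i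

instance (M : GrMod 𝒜) : SMulCommClass A k M := IsScalarTower.to_smulCommClass'

/-- Graded homomorphisms of degree `0`, as a `k`-subspace of all `Λ`-homomorphisms. -/
def homs (M N : GrMod 𝒜) : Submodule k (M →ₗ[A] N) where
  carrier := {f | ∀ i, ∀ m ∈ M.gr i, f m ∈ N.gr i}
  add_mem' hf hg i m hm := (N.gr i).add_mem (hf i m hm) (hg i m hm)
  zero_mem' i _ _ := (N.gr i).zero_mem
  smul_mem' c _ hf i m hm := (N.gr i).smul_mem c (hf i m hm)

instance : Category.{u} (GrMod 𝒜) where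
  Hom M N := homs M N
  id M := ⟨LinearMap.id, fun _ _ hm => hm⟩
  comp f g := ⟨g.1 ∘ₗ f.1, fun i m hm => g.2 i _ (f.2 i m hm)⟩

/-- The underlying `Λ`-linear map of a morphism. -/
def Hom.lin {M N : GrMod 𝒜} (f : M ⟶ N) : M →ₗ[A] N := Subtype.val f

/-- A graded homomorphism, as a morphism of graded modules. -/
def ofLin {M N : GrMod 𝒜} (f : M →ₗ[A] N) (hf : ∀ i, ∀ m ∈ M.gr i, f m ∈ N.gr i) : M ⟶ N :=
  ⟨f, hf⟩

theorem lin_mem {M N : GrMod 𝒜} (f : M ⟶ N) {i : ℤ} {m : M} (hm : m ∈ M.gr i) :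
    Hom.lin f m ∈ N.gr i := f.2 i m hm

@[ext] theorem hom_ext {M N : GrMod 𝒜} {f g : M ⟶ N} (h : ∀ x, Hom.lin f x = Hom.lin g x) :
    f = g := Subtype.ext (LinearMap.ext h)

@[simp] theorem lin_ofLin {M N : GrMod 𝒜} (f : M →ₗ[A] N) (hf) :
    Hom.lin (ofLin f hf : M ⟶ N) = f := rfl

@[simp] theorem lin_id (M : GrMod 𝒜) : Hom.lin (𝟙 M) = LinearMap.id := rfl

@[simp] theorem lin_comp {M N L : GrMod 𝒜} (f : M ⟶ N) (g : N ⟶ L) :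
    Hom.lin (f ≫ g) = Hom.lin g ∘ₗ Hom.lin f := rfl

instance (M N : GrMod 𝒜) : AddCommGroup (M ⟶ N) := inferInstanceAs (AddCommGroup (homs M N))

instance (M N : GrMod 𝒜) : Module k (M ⟶ N) := inferInstanceAs (Module k (homs M N))

@[simp] theorem lin_add {M N : GrMod 𝒜} (f g : M ⟶ N) :
    Hom.lin (f + g) = Hom.lin f + Hom.lin g := rfl

@[simp] theorem lin_zero {M N : GrMod 𝒜} : Hom.lin (0 : M ⟶ N) = 0 := rfl

@[simp] theorem lin_smul {M N : GrMod 𝒜} (c : k) (f : M ⟶ N) :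
    Hom.lin (c • f) = c • Hom.lin f := rfl

instance : Preadditive (GrMod 𝒜) where
  add_comp _ _ _ f f' g := by ext; simp
  comp_add _ _ _ f g g' := by ext; simp

theorem lin_base_smul {M N : GrMod 𝒜} (f : M ⟶ N) (c : k) (x : M) :
    Hom.lin f (c • x) = c • Hom.lin f x := LinearMap.map_smul_of_tower _ c x

instance : Linear k (GrMod 𝒜) where
  smul_comp _ _ _ r f g := by ext; simp
  comp_smul _ _ _ f r g := by ext; simp

/-- The underlying `k`-linear map of a morphism. -/
def Hom.klin {M N : GrMod 𝒜} (f : M ⟶ N) : M →ₗ[k] N := (Hom.lin f).restrictScalars k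

theorem proj_lin {M N : GrMod 𝒜} (f : M ⟶ N) (i : ℤ) (x : M) :
    N.proj i (Hom.lin f x) = Hom.lin f (M.proj i x) := by
  refine graded_induction M.isInternal (P := fun x => N.proj i (Hom.lin f x) =
    Hom.lin f (M.proj i x)) (by simp) (fun x y hx hy => by simp only [map_add, hx, hy]) (fun j x hx => ?_) x
  by_cases hij : j = i
  · subst hij
    rw [proj, proj, gradedProj_same _ hx, gradedProj_same _ (lin_mem f hx)]
  · rw [proj, proj, gradedProj_ne _ hij hx, gradedProj_ne _ hij (lin_mem f hx), map_zero]

/-! #### Graded submodules, quotients and products -/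

/-- A submodule of a graded module is graded if it contains the homogeneous components of each of
its elements. -/
def IsGradedSub (M : GrMod 𝒜) (S : Submodule A M) : Prop := ∀ i, ∀ x ∈ S, M.proj i x ∈ S

/-- A graded submodule, as a graded module: `S_i = S ∩ M_i`. -/
def sub (M : GrMod 𝒜) (S : Submodule A M) (hS : M.IsGradedSub S) : GrMod 𝒜 where
  carrier := S
  gr i := (M.gr i).comap (S.subtype.restrictScalars k)
  isInternal := by
    refine isInternal_of_proj _
      (fun i => ((M.proj i).restrict (p := S.restrictScalars k) (q := S.restrictScalars k)
        (hS i) : (S.restrictScalars k) →ₗ[k] (S.restrictScalars k))) ?_ ?_ ?_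
    · intro i x hx
      exact Subtype.ext (gradedProj_same M.isInternal hx)
    · intro i j hij x hx
      exact Subtype.ext (gradedProj_ne M.isInternal hij hx)
    · rw [eq_top_iff]
      intro x _
      have hx := mem_span_gradedProj M.isInternal (x : M)
      have hle : Submodule.span k (Set.range fun i => gradedProj M.isInternal i (x : M)) ≤
          (⨆ i, (M.gr i).comap (S.subtype.restrictScalars k)).map
            (S.subtype.restrictScalars k) := by
        rw [Submodule.span_le]
        rintro _ ⟨i, rfl⟩
        exact ⟨⟨M.proj i x, hS i x x.2⟩, Submodule.mem_iSup_of_mem i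
          (gradedProj_mem M.isInternal i (x : M)), rfl⟩
      obtain ⟨y, hy, hyx⟩ := hle hx
      rwa [show y = x from Subtype.ext hyx] at hy
  smul_mem ha hm := M.smul_mem ha hm

/-- The quotient by a graded submodule, as a graded module: `(M/S)_i` is the image of `M_i`. -/
def quot (M : GrMod 𝒜) (S : Submodule A M) (hS : M.IsGradedSub S) : GrMod 𝒜 where
  carrier := M ⧸ S
  gr i := (M.gr i).map (S.mkQ.restrictScalars k)
  isInternal := by
    refine isInternal_of_proj _
      (fun i => ((S.restrictScalars k).mapQ (S.restrictScalars k) (M.proj i) (hS i) :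
        (M ⧸ S.restrictScalars k) →ₗ[k] (M ⧸ S.restrictScalars k))) ?_ ?_ ?_
    · rintro i _ ⟨x, hx, rfl⟩
      exact congrArg S.mkQ (gradedProj_same M.isInternal hx)
    · rintro i j hij _ ⟨x, hx, rfl⟩
      exact (congrArg S.mkQ (gradedProj_ne M.isInternal hij hx)).trans (map_zero _)
    · rw [← Submodule.map_iSup, M.isInternal.submodule_iSup_eq_top, Submodule.map_top,
        LinearMap.range_eq_top]
      exact S.mkQ_surjective
  smul_mem := by
    rintro i j a _ ha ⟨x, hx, rfl⟩
    exact ⟨a • x, M.smul_mem ha hx, rfl⟩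

/-- The direct sum of two graded modules. -/
def prod (M N : GrMod 𝒜) : GrMod 𝒜 where
  carrier := M × N
  gr i := (M.gr i).prod (N.gr i)
  isInternal := by
    refine isInternal_of_proj _ (fun i => (M.proj i).prodMap (N.proj i)) ?_ ?_ ?_
    · intro i x hx
      exact Prod.ext (gradedProj_same _ hx.1) (gradedProj_same _ hx.2)
    · intro i j hij x hx
      exact Prod.ext (gradedProj_ne _ hij hx.1) (gradedProj_ne _ hij hx.2)
    · rw [eq_top_iff]
      have h1 : (⊤ : Submodule k M).map (LinearMap.inl k M N) ≤
          ⨆ i, (M.gr i).prod (N.gr i) := by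
        rw [← M.isInternal.submodule_iSup_eq_top, Submodule.map_iSup]
        refine iSup_mono fun i => ?_
        rintro _ ⟨x, hx, rfl⟩
        exact ⟨hx, (N.gr i).zero_mem⟩
      have h2 : (⊤ : Submodule k N).map (LinearMap.inr k M N) ≤
          ⨆ i, (M.gr i).prod (N.gr i) := by
        rw [← N.isInternal.submodule_iSup_eq_top, Submodule.map_iSup]
        refine iSup_mono fun i => ?_
        rintro _ ⟨x, hx, rfl⟩
        exact ⟨(M.gr i).zero_mem, hx⟩
      rintro ⟨x, y⟩ _
      have := Submodule.add_mem _ (h1 ⟨x, trivial, rfl⟩) (h2 ⟨y, trivial, rfl⟩)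
      simpa using this
  smul_mem ha hm := ⟨M.smul_mem ha hm.1, N.smul_mem ha hm.2⟩

/-- The zero module. -/
def zeroMod (𝒜 : ℕ → Submodule k A) : GrMod 𝒜 where
  carrier := PUnit
  gr _ := ⊤
  isInternal := isInternal_of_proj _ (fun _ => LinearMap.id) (fun _ _ _ => rfl)
    (fun _ _ _ _ _ => Subsingleton.elim _ _) (by simp)
  smul_mem _ _ := trivial

/-! #### `Gr(Λ)` is an abelian category -/

instance : HasZeroObject (GrMod 𝒜) :=
  ⟨zeroMod 𝒜, (IsZero.iff_id_eq_zero _).2 (hom_ext fun _ => rfl)⟩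

theorem isGradedSub_ker {M N : GrMod 𝒜} (f : M ⟶ N) :
    M.IsGradedSub (LinearMap.ker (Hom.lin f)) := fun i x hx => by
  rw [LinearMap.mem_ker] at hx ⊢
  rw [← proj_lin, hx, map_zero]

theorem isGradedSub_range {M N : GrMod 𝒜} (f : M ⟶ N) :
    N.IsGradedSub (LinearMap.range (Hom.lin f)) := by
  rintro i _ ⟨x, rfl⟩
  exact ⟨M.proj i x, (proj_lin f i x).symm⟩

/-- The inclusion of a graded submodule. -/
def subι (M : GrMod 𝒜) (S : Submodule A M) (hS : M.IsGradedSub S) : M.sub S hS ⟶ M :=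
  ofLin S.subtype fun _ _ hm => hm

/-- The projection onto the quotient by a graded submodule. -/
def quotπ (M : GrMod 𝒜) (S : Submodule A M) (hS : M.IsGradedSub S) : M ⟶ M.quot S hS :=
  ofLin S.mkQ fun _ m hm => ⟨m, hm, rfl⟩

theorem lin_apply_eq_zero {M N L : GrMod 𝒜} {f : M ⟶ N} {g : N ⟶ L} (w : f ≫ g = 0) (x : M) :
    Hom.lin g (Hom.lin f x) = 0 :=
  congrArg (fun h => Hom.lin h x) w

/-- The concrete kernel is a kernel. -/
def kernelIsLimit {M N : GrMod 𝒜} (f : M ⟶ N) :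
    IsLimit (KernelFork.ofι (f := f) (M.subι _ (isGradedSub_ker f))
      (hom_ext fun x => x.2)) :=
  KernelFork.IsLimit.ofι _ _
    (fun g w => ofLin ((Hom.lin g).codRestrict _ fun x => lin_apply_eq_zero w x)
      fun _ _ hm => lin_mem g hm)
    (fun _ _ => rfl)
    (fun _ _ _ hm => hom_ext fun x => Subtype.ext (congrArg (fun h => Hom.lin h x) hm))

/-- The concrete cokernel is a cokernel. -/
def cokernelIsColimit {M N : GrMod 𝒜} (f : M ⟶ N) :
    IsColimit (CokernelCofork.ofπ (f := f) (N.quotπ _ (isGradedSub_range f))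
      (hom_ext fun x => (Submodule.Quotient.mk_eq_zero _).2 ⟨x, rfl⟩)) :=
  CokernelCofork.IsColimit.ofπ _ _
    (fun g w => ofLin (Submodule.liftQ _ (Hom.lin g) (by
        rintro _ ⟨x, rfl⟩
        exact lin_apply_eq_zero w x))
      (by
        rintro i _ ⟨x, hx, rfl⟩
        exact lin_mem g hx))
    (fun _ _ => rfl)
    (fun _ _ _ hm => hom_ext fun x => by
      obtain ⟨y, rfl⟩ := Submodule.mkQ_surjective _ x
      exact congrArg (fun h => Hom.lin h y) hm)

instance : HasKernels (GrMod 𝒜) := ⟨fun f => ⟨⟨⟨_, kernelIsLimit f⟩⟩⟩⟩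

instance : HasCokernels (GrMod 𝒜) := ⟨fun f => ⟨⟨⟨_, cokernelIsColimit f⟩⟩⟩⟩

/-- The direct sum of two graded modules as a bicone. -/
def prodBicone (M N : GrMod 𝒜) : BinaryBicone M N where
  pt := M.prod N
  fst := ofLin (LinearMap.fst A M N) fun _ _ hm => hm.1
  snd := ofLin (LinearMap.snd A M N) fun _ _ hm => hm.2
  inl := ofLin (LinearMap.inl A M N) fun i _ hm => ⟨hm, (N.gr i).zero_mem⟩
  inr := ofLin (LinearMap.inr A M N) fun i _ hm => ⟨(M.gr i).zero_mem, hm⟩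

instance : HasBinaryBiproducts (GrMod 𝒜) where
  has_binary_biproduct M N := hasBinaryBiproduct_of_total (prodBicone M N) <|
    hom_ext fun x => Prod.ext (add_zero x.1) (zero_add x.2)

instance : HasFiniteProducts (GrMod 𝒜) := hasFiniteProducts_of_has_binary_and_terminal

theorem injective_of_mono {M N : GrMod 𝒜} (f : M ⟶ N) [Mono f] :
    Function.Injective (Hom.lin f) := by
  rw [← LinearMap.ker_eq_bot, eq_bot_iff]
  intro x hx
  have h0 : M.subι _ (isGradedSub_ker f) = 0 :=
    Preadditive.mono_iff_cancel_zero f |>.1 inferInstance _ _ (hom_ext fun y => y.2)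
  exact congrArg (fun h => Hom.lin h (⟨x, hx⟩ : LinearMap.ker (Hom.lin f))) h0

theorem surjective_of_epi {M N : GrMod 𝒜} (f : M ⟶ N) [Epi f] :
    Function.Surjective (Hom.lin f) := by
  intro x
  have h0 : N.quotπ _ (isGradedSub_range f) = 0 :=
    Preadditive.epi_iff_cancel_zero f |>.1 inferInstance _ _
      (hom_ext fun y => (Submodule.Quotient.mk_eq_zero _).2 ⟨y, rfl⟩)
  exact (Submodule.Quotient.mk_eq_zero _).1 (congrArg (fun h => Hom.lin h x) h0)

theorem mem_gr_of_lin_mem {M N : GrMod 𝒜} (f : M ⟶ N) (hf : Function.Injective (Hom.lin f))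
    {i : ℤ} {x : M} (hx : Hom.lin f x ∈ N.gr i) : x ∈ M.gr i := by
  have : M.proj i x = x := hf ((proj_lin f i x).symm.trans (gradedProj_same N.isInternal hx))
  rw [← this]
  exact gradedProj_mem _ _ _

theorem exists_lift_mem_gr {M N : GrMod 𝒜} (f : M ⟶ N) (hf : Function.Surjective (Hom.lin f))
    {i : ℤ} {y : N} (hy : y ∈ N.gr i) : ∃ x ∈ M.gr i, Hom.lin f x = y := by
  obtain ⟨x, rfl⟩ := hf y
  exact ⟨M.proj i x, gradedProj_mem _ _ _,
    (proj_lin f i x).symm.trans (gradedProj_same N.isInternal hy)⟩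

instance : IsNormalMonoCategory (GrMod 𝒜) where
  normalMonoOfMono {M N} f _ := by
    have hf := injective_of_mono f
    let e := LinearEquiv.ofInjective (Hom.lin f) hf
    have he : ∀ y, Hom.lin f (e.symm y) = y := fun y =>
      congrArg Subtype.val (e.apply_symm_apply y)
    have hr : ∀ {L : GrMod 𝒜} (g : L ⟶ N) (_ : g ≫ N.quotπ _ (isGradedSub_range f) = 0) (x : L),
        Hom.lin g x ∈ LinearMap.range (Hom.lin f) := fun g w x =>
      (Submodule.Quotient.mk_eq_zero _).1 (lin_apply_eq_zero w x)
    refine ⟨⟨_, N.quotπ _ (isGradedSub_range f),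
      hom_ext fun y => (Submodule.Quotient.mk_eq_zero _).2 ⟨y, rfl⟩,
      KernelFork.IsLimit.ofι _ _
        (fun g w => ofLin (e.symm.toLinearMap ∘ₗ (Hom.lin g).codRestrict _ (hr g w))
          fun i m hm => mem_gr_of_lin_mem f hf ?_)
        (fun g w => hom_ext fun x => he _)
        (fun g w m hm => (cancel_mono f).1 (hm.trans (hom_ext fun x => (he ⟨_, hr g w x⟩).symm)))⟩⟩
    exact (he ⟨_, hr g w m⟩).symm ▸ lin_mem g hm

instance : IsNormalEpiCategory (GrMod 𝒜) where
  normalEpiOfEpi {M N} f _ := by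
    have hf := surjective_of_epi f
    let e := (Hom.lin f).quotKerEquivOfSurjective hf
    have he : ∀ x, e.symm (Hom.lin f x) = Submodule.Quotient.mk x := fun x =>
      e.symm_apply_eq.2 rfl
    have hr : ∀ {L : GrMod 𝒜} (g : M ⟶ L) (_ : M.subι _ (isGradedSub_ker f) ≫ g = 0),
        LinearMap.ker (Hom.lin f) ≤ LinearMap.ker (Hom.lin g) := fun g w x hx =>
      lin_apply_eq_zero w (⟨x, hx⟩ : LinearMap.ker (Hom.lin f))
    have hd : ∀ {L : GrMod 𝒜} (g : M ⟶ L) (w : M.subι _ (isGradedSub_ker f) ≫ g = 0) (x : M),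
        (Submodule.liftQ _ (Hom.lin g) (hr g w) ∘ₗ e.symm.toLinearMap) (Hom.lin f x) =
          Hom.lin g x := fun g w x =>
      congrArg (Submodule.liftQ _ (Hom.lin g) (hr g w)) (he x)
    refine ⟨⟨_, M.subι _ (isGradedSub_ker f), hom_ext fun x => x.2,
      CokernelCofork.IsColimit.ofπ _ _
        (fun g w => ofLin (Submodule.liftQ _ (Hom.lin g) (hr g w) ∘ₗ e.symm.toLinearMap)
          fun i y hy => ?_)
        (fun g w => hom_ext fun x => hd g w x)
        (fun g w m hm => (cancel_epi f).1 (hm.trans (hom_ext fun x => (hd g w x).symm)))⟩⟩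
    obtain ⟨x, hx, rfl⟩ := exists_lift_mem_gr f hf hy
    rw [hd g w x]
    exact lin_mem g hx

instance : Abelian (GrMod 𝒜) where

/-- The extension groups `Ext^n` of the abelian category `Gr(Λ)`. -/
instance : HasExt.{max (u + 1) w} (GrMod 𝒜) := HasExt.standard _

/-! #### Shifts, powers of the radical, the trivial module -/

/-- The shift `M[n]`, with `M[n]_i = M_{i-n}`. -/
def shift (M : GrMod 𝒜) (n : ℤ) : GrMod 𝒜 where
  carrier := M
  gr i := M.gr (i - n)
  isInternal := by
    refine isInternal_of_proj _ (fun i => M.proj (i - n)) ?_ ?_ ?_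
    · intro i x hx
      exact gradedProj_same _ hx
    · intro i j hij x hx
      exact gradedProj_ne _ (by omega) hx
    · rw [← M.isInternal.submodule_iSup_eq_top]
      exact (Equiv.subRight n).iSup_comp (g := M.gr)
  smul_mem {i j a m} ha hm := by
    rw [add_sub_assoc]
    exact M.smul_mem ha hm

theorem proj_smul (M : GrMod 𝒜) {n : ℕ} {a : A} (ha : a ∈ 𝒜 n) (i : ℤ) (x : M) :
    M.proj i (a • x) = a • M.proj (i - n) x := by
  refine graded_induction M.isInternal (P := fun x => M.proj i (a • x) = a • M.proj (i - n) x)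
    (by simp) (fun x y hx hy => by simp only [smul_add, map_add, hx, hy]) (fun j x hx => ?_) x
  by_cases hij : n + j = i
  · obtain rfl : j = i - n := by omega
    rw [proj, proj, gradedProj_same _ hx]
    exact gradedProj_same _ (hij ▸ M.smul_mem ha hx)
  · rw [proj, proj, gradedProj_ne _ (by omega) hx, gradedProj_ne _ hij (M.smul_mem ha hx),
      smul_zero]

section Radical

variable [GradedAlgebra 𝒜]

theorem isGradedSub_smul (M : GrMod 𝒜) {S : Submodule A M} (hS : M.IsGradedSub S) :
    M.IsGradedSub ((HomogeneousIdeal.irrelevant 𝒜).toIdeal • S) := by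
  intro i x hx
  refine Submodule.smul_induction_on hx (fun a ha s hs => ?_) fun x y hx hy => ?_
  · have ha' : a ∈ (HomogeneousIdeal.irrelevant 𝒜).toAddSubmonoid := ha
    rw [HomogeneousIdeal.irrelevant_eq_closure] at ha'
    refine AddSubmonoid.closure_induction (fun b hb => ?_) ?_ (fun b c _ _ hb hc => ?_) ha'
    · obtain ⟨n, hn, hb⟩ := Set.mem_iUnion₂.1 hb
      rw [proj_smul M hb]
      exact Submodule.smul_mem_smul (HomogeneousIdeal.mem_irrelevant_of_mem 𝒜 hn hb) (hS _ _ hs)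
    · rw [zero_smul, map_zero]
      exact Submodule.zero_mem _
    · rw [add_smul, map_add]
      exact Submodule.add_mem _ hb hc
  · rw [map_add]
    exact Submodule.add_mem _ hx hy

theorem isGradedSub_pow_smul (M : GrMod 𝒜) (i : ℕ) :
    M.IsGradedSub ((HomogeneousIdeal.irrelevant 𝒜).toIdeal ^ i • (⊤ : Submodule A M)) := by
  induction i with
  | zero =>
    rw [Submodule.pow_zero, Ideal.one_eq_top, Submodule.top_smul]
    exact fun _ _ _ => trivial
  | succ n ih =>
    rcases eq_or_ne n 0 with rfl | hn
    · rw [zero_add, Submodule.pow_one]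
      exact isGradedSub_smul M fun _ _ _ => trivial
    · rw [Submodule.pow_succ' _ hn, Submodule.mul_smul]
      exact isGradedSub_smul M ih

/-- The graded submodule `J^i M`, where `J = ⨁_{i ≥ 1} Λ_i`. -/
def radPow (M : GrMod 𝒜) (i : ℕ) : GrMod 𝒜 :=
  M.sub ((HomogeneousIdeal.irrelevant 𝒜).toIdeal ^ i • ⊤) (M.isGradedSub_pow_smul i)

variable (𝒜) in
/-- The trivial module `Λ₀`, concentrated in degree `0`: the module `Λ₀` over itself, lifted along
the projection `Λ → Λ/J = Λ₀`. -/
def trivialMod : GrMod 𝒜 :=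
  letI : Module A (𝒜 0) := Module.compHom (𝒜 0) (GradedRing.projZeroRingHom' 𝒜)
  { carrier := 𝒜 0
    isScalarTower := ⟨fun c a x => by
      apply Subtype.ext
      change GradedRing.projZeroRingHom 𝒜 (c • a) * (x : A) =
        c • (GradedRing.projZeroRingHom 𝒜 a * (x : A))
      simp [GradedRing.projZeroRingHom_apply, DirectSum.decompose_smul, DirectSum.smul_apply]⟩
    gr := fun i => if i = 0 then ⊤ else ⊥
    isInternal := by
      refine isInternal_of_proj _ (fun i => if i = 0 then LinearMap.id else 0) ?_ ?_ ?_
      · intro i x hx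
        split_ifs at hx ⊢ with hi
        · rfl
        · exact ((Submodule.mem_bot k).1 hx).symm
      · intro i j hij x hx
        by_cases hj : j = 0
        · rw [if_neg (by omega)] at hx
          rw [(Submodule.mem_bot k).1 hx, map_zero]
        · rw [if_neg hj]
          rfl
      · rw [eq_top_iff]
        exact le_iSup_of_le 0 (by simp)
    smul_mem := by
      intro i j a m ha hm
      by_cases hj : j = 0
      · by_cases hi : i = 0
        · rw [if_pos (by omega)]
          trivial
        · rw [if_neg (by omega), Submodule.mem_bot]
          apply Subtype.ext
          change GradedRing.projZeroRingHom 𝒜 a * (m : A) = 0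
          rw [GradedRing.projZeroRingHom_apply, DirectSum.decompose_of_mem_ne 𝒜 ha hi, zero_mul]
      · rw [if_neg hj] at hm
        rw [(Submodule.mem_bot k).1 hm, smul_zero]
        exact Submodule.zero_mem _ }

end Radical

/-! ### `d`-Koszul and generalized `d`-Koszul modules -/

/-- `M` is generated in degrees in `I` if `M = Λ (⨁_{j ∈ I} M_j)`. -/
def GeneratedInDegrees (M : GrMod 𝒜) (I : Set ℤ) : Prop :=
  Submodule.span A (⋃ j ∈ I, (M.gr j : Set M)) = ⊤

/-- `M` admits a finitely generated graded projective resolution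
`⋯ → Q^1 → Q^0 → M → 0` such that each `Q^i` is generated in degrees in `D i`. -/
def HasResolutionInDegrees (M : GrMod 𝒜) (D : ℕ → Set ℤ) : Prop :=
  ∃ Q : ProjectiveResolution M, ∀ i : ℕ,
    Module.Finite A (Q.complex.X i) ∧ (Q.complex.X i).GeneratedInDegrees (D i)

/-- `δ(2n) = nd` and `δ(2n+1) = nd + 1`. -/
def delta (d i : ℕ) : ℤ := if Even i then (i / 2 : ℕ) * d else (i / 2 : ℕ) * d + 1

/-- `Δ(2n) = {nd}` and `Δ(2n+1) = {nd + 1, …, nd + d - 1}`. -/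
def Delta (d i : ℕ) : Set ℤ :=
  if Even i then {((i / 2 : ℕ) * d : ℤ)}
  else Set.Icc ((i / 2 : ℕ) * d + 1 : ℤ) ((i / 2 : ℕ) * d + d - 1)

/-- `d`-Koszul modules. -/
def IsDKoszul (d : ℕ) (M : GrMod 𝒜) : Prop :=
  M.HasResolutionInDegrees fun i => {delta d i}

/-- Generalized `d`-Koszul modules. -/
def IsGeneralizedDKoszul (d : ℕ) (M : GrMod 𝒜) : Prop :=
  M.HasResolutionInDegrees (Delta d)

end GrMod

/-- A standardly graded algebra `Λ` is a `d`-Koszul algebra if the trivial module `Λ₀` is a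
`d`-Koszul module. -/
structure IsDKoszulAlgebra {k : Type w} [Field k] {A : Type u} [Ring A] [Algebra k A]
    (𝒜 : ℕ → Submodule k A) [GradedAlgebra 𝒜] (d : ℕ) : Prop where
  isStandardlyGraded : IsStandardlyGraded 𝒜
  isDKoszul : (GrMod.trivialMod 𝒜).IsDKoszul d

/-! ### Vanishing of `Ext` groups in an abelian category -/

namespace CategoryTheory.Abelian.Ext

universe w' v' u'

variable {C : Type u'} [Category.{v'} C] [Abelian C] [HasExt.{w'} C]

/-! Generalized `d`-Koszulity is detected by `Ext`: for `M` finitely generated over a standardly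
graded `Λ` it means that `Ext^m(M, Λ₀[j]) = 0` whenever `j ∉ Δ(m)`. One direction is read off a
resolution (`HasResolutionInDegrees.extTrivialVanishes`). For the other
(`hasResolutionInDegrees_of_extTrivialVanishes`), take projective covers repeatedly. Every morphism
from the cover to `Λ₀[j]` kills the kernel, so it comes from the module, and vanishing of `Ext¹`
leaves no nonzero morphism from the kernel to `Λ₀[j]`. Graded Nakayama then locates the generators.
`Λ` need not be noetherian: syzygies are finitely generated because they are locally finite and
generated in finitely many degrees.

Since `Δ(0) = {0}`, `M` is generated in degree `0`, so `J^i M = M_{≥ i}` (`radPow_eq_trunc`), and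
there are exact sequences `0 → M_{≥ i+1} → M_{≥ i} → M_i → 0`. The quotient `M_i` is
finite-dimensional and killed by `J`, hence a summand of finitely many copies of `Λ₀[i]`. As `Λ` is
`d`-Koszul, `Ext^m(M_i, Λ₀[j]) = 0` unless `j = i + δ(m)` (`extTrivialVanishes_of_concentrated`).

For (i), show by induction on `i` that `Ext^m(M_{≥ i}, Λ₀[j]) = 0` when `j - i ∉ Δ(m)`. Below `i +
δ(m)` this holds for any locally finite module (`trunc_extTrivialVanishes`). For `M_{≥ i+1}` and `j
≥ i + 1 + δ(m)`, the group lies between `Ext^m(M_{≥ i}, Λ₀[j])` and `Ext^{m+1}(M_i, Λ₀[j])`, and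
both vanish by the arithmetic of `Δ` and `δ`.

For (ii), restriction from `M_{≥ s}` to `M_{≥ s+1}` is bijective on `Ext^{2n-1}(-, Λ₀[nd])` once
`Ext^{2n-1}` and `Ext^{2n}` of `M_s` into `Λ₀[nd]` vanish. These can be nonzero only for `s = d - 1`
and `s = 0` respectively, so `1 ≤ s ≤ d - 2` is safe. -/

theorem subsingleton_X₁ {S : ShortComplex C} (hS : S.ShortExact) {Y : C} {n : ℕ}
    (h₂ : Subsingleton (Ext S.X₂ Y n)) (h₃ : Subsingleton (Ext S.X₃ Y (n + 1))) :
    Subsingleton (Ext S.X₁ Y n) := by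
  refine subsingleton_of_forall_eq 0 fun x => ?_
  obtain ⟨y, rfl⟩ := contravariant_sequence_exact₁ hS Y x (add_comm 1 n) (Subsingleton.elim _ _)
  rw [Subsingleton.elim y 0, comp_zero]

theorem subsingleton_X₂ {S : ShortComplex C} (hS : S.ShortExact) {Y : C} {n : ℕ}
    (h₁ : Subsingleton (Ext S.X₁ Y n)) (h₃ : Subsingleton (Ext S.X₃ Y n)) :
    Subsingleton (Ext S.X₂ Y n) := by
  refine subsingleton_of_forall_eq 0 fun x => ?_
  obtain ⟨y, rfl⟩ := contravariant_sequence_exact₂ hS Y x (Subsingleton.elim _ _)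
  rw [Subsingleton.elim y 0, comp_zero]

theorem subsingleton_X₃ {S : ShortComplex C} (hS : S.ShortExact) {Y : C} {n : ℕ}
    (h₁ : Subsingleton (Ext S.X₁ Y n)) (h₂ : Subsingleton (Ext S.X₂ Y (n + 1))) :
    Subsingleton (Ext S.X₃ Y (n + 1)) := by
  refine subsingleton_of_forall_eq 0 fun x => ?_
  obtain ⟨y, rfl⟩ := contravariant_sequence_exact₃ hS Y x (Subsingleton.elim _ _) (add_comm 1 n)
  rw [Subsingleton.elim y 0, comp_zero]

theorem subsingleton_zero_iff {X Y : C} :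
    Subsingleton (Ext X Y 0) ↔ ∀ f : X ⟶ Y, f = 0 := by
  rw [addEquiv₀.toEquiv.subsingleton_congr]
  exact ⟨fun _ f => Subsingleton.elim _ _, fun h => subsingleton_of_forall_eq 0 h⟩

/-- A morphism on the kernel of an epimorphism `P ⟶ X` extends to `P` if `Ext¹(X, Y) = 0`. -/
theorem exists_extension {S : ShortComplex C} (hS : S.ShortExact) {Y : C}
    (h₃ : Subsingleton (Ext S.X₃ Y 1)) (g : S.X₁ ⟶ Y) : ∃ g' : S.X₂ ⟶ Y, S.f ≫ g' = g := by
  obtain ⟨y, hy⟩ := contravariant_sequence_exact₁ hS Y (mk₀ g) (add_comm 1 0)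
    (Subsingleton.elim _ _)
  obtain ⟨g', rfl⟩ := addEquiv₀.symm.surjective y
  refine ⟨g', addEquiv₀.symm.injective ?_⟩
  simpa using hy

/-- If every morphism from the kernel of an epimorphism `P ⟶ X` extends to the projective object
`P`, then `Ext¹(X, Y) = 0`. -/
theorem subsingleton_one_of_extension {S : ShortComplex C} (hS : S.ShortExact) [Projective S.X₂]
    {Y : C} (h : ∀ g : S.X₁ ⟶ Y, ∃ g' : S.X₂ ⟶ Y, S.f ≫ g' = g) :
    Subsingleton (Ext S.X₃ Y 1) := by
  refine subsingleton_of_forall_eq 0 fun x => ?_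
  obtain ⟨y, rfl⟩ := contravariant_sequence_exact₃ hS Y x (eq_zero_of_projective _)
    (add_comm 1 0)
  obtain ⟨g, rfl⟩ := addEquiv₀.symm.surjective y
  obtain ⟨g', rfl⟩ := h g
  simp [← mk₀_comp_mk₀, ← comp_assoc_of_second_deg_zero]

/-- `Ext^n(X, Y) = 0` if the identity of `X` is a sum of morphisms which factor through objects
`Z` with `Ext^n(Z, Y) = 0`. -/
theorem subsingleton_of_sum_comp {X Y Z : C} {n : ℕ} {ι : Type*} (s : Finset ι) (p : ι → (X ⟶ Z))
    (q : ι → (Z ⟶ X)) (h : 𝟙 X = ∑ i ∈ s, p i ≫ q i) (hZ : Subsingleton (Ext Z Y n)) :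
    Subsingleton (Ext X Y n) := by
  refine subsingleton_of_forall_eq 0 fun x => ?_
  have h1 : mk₀ (𝟙 X) = ∑ i ∈ s, mk₀ (p i ≫ q i) := by
    rw [h]
    exact map_sum (addEquiv₀ (C := C) (X := X) (Y := X)).symm _ _
  have h2 : x = ∑ i ∈ s, (mk₀ (p i ≫ q i)).comp x (zero_add n) := by
    conv_lhs => rw [← mk₀_id_comp x, h1]
    exact map_sum (((bilinearComp X X Y 0 n n (zero_add n)).flip x)) _ _
  rw [h2]
  refine Finset.sum_eq_zero fun i _ => ?_
  rw [← mk₀_comp_mk₀_assoc, Subsingleton.elim ((mk₀ (q i)).comp x (zero_add n)) 0, comp_zero]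

theorem subsingleton_of_iso {X Y Z : C} {n : ℕ} (e : X ≅ Z) (hZ : Subsingleton (Ext Z Y n)) :
    Subsingleton (Ext X Y n) :=
  subsingleton_of_sum_comp {()} (fun _ => e.hom) (fun _ => e.inv) (by simp) hZ

/-- A class in `Ext^n` is represented by a cocycle on the `n`-th term of the resolution, and here
the only cochain is zero. -/
theorem subsingleton_of_projectiveResolution {X Y : C} (R : ProjectiveResolution X) {n : ℕ}
    (h : ∀ f : R.complex.X n ⟶ Y, f = 0) : Subsingleton (Ext X Y n) := by
  refine subsingleton_of_forall_eq 0 fun x => ?_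
  obtain ⟨f, hf, rfl⟩ := R.extMk_surjective x (n + 1) rfl
  obtain rfl := h f
  simp

/-- A short exact sequence induces an isomorphism `Ext^n(X₂, Y) ≃ Ext^n(X₁, Y)` if the
neighbouring extension groups of `X₃` vanish. -/
theorem nonempty_linearEquiv_of_subsingleton (R : Type*) [CommRing R] [Linear R C]
    {S : ShortComplex C} (hS : S.ShortExact) {Y : C} {n : ℕ}
    (h : Subsingleton (Ext S.X₃ Y n)) (h' : Subsingleton (Ext S.X₃ Y (n + 1))) :
    Nonempty (Ext S.X₂ Y n ≃ₗ[R] Ext S.X₁ Y n) := by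
  refine ⟨LinearEquiv.ofBijective ((mk₀ S.f).precompOfLinear R Y (zero_add n)) ⟨?_, fun x => ?_⟩⟩
  · rw [← LinearMap.ker_eq_bot, eq_bot_iff]
    intro x hx
    obtain ⟨y, rfl⟩ := contravariant_sequence_exact₂ hS Y x hx
    rw [Subsingleton.elim y 0, comp_zero]
    exact zero_mem _
  · exact contravariant_sequence_exact₁ hS Y x (add_comm 1 n) (Subsingleton.elim _ _)

end CategoryTheory.Abelian.Ext

/-! ### Projective resolutions from sequences of syzygies -/

namespace CategoryTheory

variable {C : Type*} [Category* C] [Abelian C]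

/-- Splicing short exact sequences `0 → N (i + 1) → Q i → N i → 0` with projective middle terms
yields a projective resolution of `N 0`. -/
theorem exists_projectiveResolution_of_syzygies (N Q : ℕ → C) (f : ∀ i, N (i + 1) ⟶ Q i)
    (g : ∀ i, Q i ⟶ N i) (w : ∀ i, f i ≫ g i = 0)
    (hS : ∀ i, (ShortComplex.mk _ _ (w i)).ShortExact) (hQ : ∀ i, Projective (Q i)) :
    ∃ R : ProjectiveResolution (N 0), ∀ i, R.complex.X i = Q i := by
  have hepi : ∀ i, Epi (g i) := fun i => (hS i).epi_g
  have hmono : ∀ i, Mono (f i) := fun i => (hS i).mono_f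
  let K : ChainComplex C ℕ := ChainComplex.of Q (fun i => g (i + 1) ≫ f i)
    (fun i => by simp [reassoc_of% (w (i + 1))])
  have hd : ∀ i, K.d (i + 1) i = g (i + 1) ≫ f i :=
    fun i => ChainComplex.of_d Q (fun i => g (i + 1) ≫ f i) i
  -- Precomposing with the epimorphisms `g` does not change images, and postcomposing with the
  -- monomorphisms `f` does not change kernels. So exactness of the spliced complex reduces to that
  -- of the given short sequences.
  have hex0 : (ShortComplex.mk (g 1 ≫ f 0) (g 0) (by simp [w])).Exact := by
    let α : ShortComplex.mk (g 1 ≫ f 0) (g 0) (by simp [w]) ⟶ ShortComplex.mk (f 0) (g 0) (w 0) :=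
      { τ₁ := g 1, τ₂ := 𝟙 _, τ₃ := 𝟙 _ }
    have : Epi α.τ₁ := hepi 1
    have : IsIso α.τ₂ := inferInstanceAs (IsIso (𝟙 _))
    have : Mono α.τ₃ := inferInstanceAs (Mono (𝟙 _))
    exact (ShortComplex.exact_iff_of_epi_of_isIso_of_mono α).2 (hS 0).exact
  have hex1 : ∀ i, (ShortComplex.mk (g (i + 2) ≫ f (i + 1)) (g (i + 1) ≫ f i)
      (by simp [reassoc_of% (w (i + 1))])).Exact := by
    intro i
    let α : ShortComplex.mk (g (i + 2) ≫ f (i + 1)) (g (i + 1)) (by simp [w]) ⟶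
        ShortComplex.mk (g (i + 2) ≫ f (i + 1)) (g (i + 1) ≫ f i)
          (by simp [reassoc_of% (w (i + 1))]) :=
      { τ₁ := 𝟙 _, τ₂ := 𝟙 _, τ₃ := f i }
    let β : ShortComplex.mk (g (i + 2) ≫ f (i + 1)) (g (i + 1)) (by simp [w]) ⟶
        ShortComplex.mk (f (i + 1)) (g (i + 1)) (w (i + 1)) :=
      { τ₁ := g (i + 2), τ₂ := 𝟙 _, τ₃ := 𝟙 _ }
    have : Epi α.τ₁ := inferInstanceAs (Epi (𝟙 _))
    have : IsIso α.τ₂ := inferInstanceAs (IsIso (𝟙 _))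
    have : Mono α.τ₃ := hmono i
    have : Epi β.τ₁ := hepi _
    have : IsIso β.τ₂ := inferInstanceAs (IsIso (𝟙 _))
    have : Mono β.τ₃ := inferInstanceAs (Mono (𝟙 _))
    exact (ShortComplex.exact_iff_of_epi_of_isIso_of_mono α).1
      ((ShortComplex.exact_iff_of_epi_of_isIso_of_mono β).2 (hS _).exact)
  let p : K ⟶ (ChainComplex.single₀ C).obj (N 0) :=
    (ChainComplex.toSingle₀Equiv _ _).symm ⟨g 0, by rw [hd]; simp [w]⟩
  have hp : p.f 0 = g 0 := ChainComplex.toSingle₀Equiv_symm_apply_f_zero _ _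
  refine ⟨{ complex := K
            projective := hQ
            π := p
            quasiIso := ⟨fun n => ?_⟩ }, fun i => rfl⟩
  cases n
  · rw [ChainComplex.quasiIsoAt₀_iff, ShortComplex.quasiIso_iff_of_zeros']
    · refine (ShortComplex.exact_and_epi_g_iff_of_iso ?_).2
        ⟨hex0, hepi 0⟩
      exact ShortComplex.isoMk (Iso.refl _) (Iso.refl _) (Iso.refl _)
        (((Category.id_comp _).trans (hd _).symm).trans (Category.comp_id _).symm)
        ((Category.id_comp _).trans (hp.symm.trans (Category.comp_id _).symm))
    all_goals rfl
  · rename_i n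
    rw [quasiIsoAt_iff_exactAt' _ _ (ChainComplex.exactAt_succ_single_obj _ _),
      HomologicalComplex.exactAt_iff' _ (n + 1 + 1) (n + 1) n (by simp) (by simp)]
    refine (ShortComplex.exact_iff_of_iso ?_).2 (hex1 n)
    exact ShortComplex.isoMk (Iso.refl _) (Iso.refl _) (Iso.refl _) 
      (((Category.id_comp _).trans (hd _).symm).trans (Category.comp_id _).symm)
      (((Category.id_comp _).trans (hd _).symm).trans (Category.comp_id _).symm)

end CategoryTheory

namespace GrMod

section Basic

variable {k : Type w} [Field k] {A : Type u} [Ring A] [Algebra k A] {𝒜 : ℕ → Submodule k A}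

/-! ### Short exact sequences of graded modules -/

theorem shortExact_of_lin {S : ShortComplex (GrMod 𝒜)} (hf : Function.Injective (Hom.lin S.f))
    (hg : Function.Surjective (Hom.lin S.g))
    (hfg : ∀ x, Hom.lin S.g x = 0 → ∃ y, Hom.lin S.f y = x) : S.ShortExact where
  exact := by
    rw [S.exact_iff_of_forks (kernelIsLimit S.g) (cokernelIsColimit S.f)]
    refine hom_ext fun x => ?_
    obtain ⟨y, hy⟩ := hfg x.1 x.2
    exact (Submodule.Quotient.mk_eq_zero _).2 ⟨y, hy⟩
  mono_f := Preadditive.mono_of_cancel_zero _ fun g hg => hom_ext fun x =>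
    hf ((lin_apply_eq_zero hg x).trans (map_zero _).symm)
  epi_g := Preadditive.epi_of_cancel_zero _ fun g hg' => hom_ext fun x => by
    obtain ⟨y, rfl⟩ := hg x
    exact lin_apply_eq_zero hg' y

/-- The short exact sequence of the kernel of a surjective morphism. -/
def kernelSeq {M N : GrMod 𝒜} (f : M ⟶ N) : ShortComplex (GrMod 𝒜) :=
  ShortComplex.mk (M.subι _ (isGradedSub_ker f)) f (hom_ext fun x => x.2)

theorem kernelSeq_shortExact {M N : GrMod 𝒜} {f : M ⟶ N}
    (hf : Function.Surjective (Hom.lin f)) : (kernelSeq f).ShortExact :=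
  shortExact_of_lin Subtype.val_injective hf fun x hx => ⟨⟨x, hx⟩, rfl⟩

/-- The short exact sequence of the cokernel of an injective morphism. -/
def cokernelSeq {M N : GrMod 𝒜} (f : M ⟶ N) : ShortComplex (GrMod 𝒜) :=
  ShortComplex.mk f (N.quotπ _ (isGradedSub_range f))
    (hom_ext fun x => (Submodule.Quotient.mk_eq_zero _).2 ⟨x, rfl⟩)

theorem cokernelSeq_shortExact {M N : GrMod 𝒜} {f : M ⟶ N}
    (hf : Function.Injective (Hom.lin f)) : (cokernelSeq f).ShortExact :=
  shortExact_of_lin hf (Submodule.mkQ_surjective _) fun _ hx =>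
    (Submodule.Quotient.mk_eq_zero _).1 hx

theorem epi_of_surjective {M N : GrMod 𝒜} {f : M ⟶ N} (hf : Function.Surjective (Hom.lin f)) :
    Epi f := (kernelSeq_shortExact hf).epi_g

/-! ### Bounded below and locally finite graded modules -/

/-- `M` is concentrated in degrees `≥ a`. -/
def IsGE (M : GrMod 𝒜) (a : ℤ) : Prop := ∀ j < a, M.gr j = ⊥

/-- All homogeneous components are finite-dimensional. -/
def IsLocallyFinite (M : GrMod 𝒜) : Prop := ∀ j, Module.Finite k (M.gr j)

theorem proj_mem (M : GrMod 𝒜) (i : ℤ) (x : M) : M.proj i x ∈ M.gr i := gradedProj_mem _ _ _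

theorem proj_same {M : GrMod 𝒜} {i : ℤ} {x : M} (hx : x ∈ M.gr i) : M.proj i x = x :=
  gradedProj_same _ hx

theorem proj_ne {M : GrMod 𝒜} {i j : ℤ} (hij : i ≠ j) {x : M} (hx : x ∈ M.gr i) :
    M.proj j x = 0 := gradedProj_ne _ hij hx

theorem span_homogeneous (N : GrMod 𝒜) : Submodule.span A {x : N | ∃ j, x ∈ N.gr j} = ⊤ := by
  refine eq_top_iff.2 fun x _ => ?_
  exact graded_induction N.isInternal (P := fun x => x ∈ Submodule.span A {x : N | ∃ j, x ∈ N.gr j})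
    (zero_mem _) (fun _ _ => add_mem) (fun j x hx => Submodule.subset_span ⟨j, hx⟩) x

theorem IsGE.of_injective {M N : GrMod 𝒜} {a : ℤ} (hN : N.IsGE a) (f : M ⟶ N)
    (hf : Function.Injective (Hom.lin f)) : M.IsGE a := fun j hj => by
  rw [eq_bot_iff]
  intro x hx
  have := lin_mem f hx
  rw [hN j hj] at this
  exact hf (this.trans (map_zero _).symm)

theorem IsGE.of_surjective {M N : GrMod 𝒜} {a : ℤ} (hM : M.IsGE a) (f : M ⟶ N)
    (hf : Function.Surjective (Hom.lin f)) : N.IsGE a := fun j hj => by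
  rw [eq_bot_iff]
  intro x hx
  obtain ⟨y, hy, rfl⟩ := exists_lift_mem_gr f hf hx
  rw [hM j hj] at hy
  rw [show y = 0 from hy, map_zero]
  exact zero_mem _

theorem finite_gr_of_injective {M N : GrMod 𝒜} (f : M ⟶ N)
    (hf : Function.Injective (Hom.lin f)) {j : ℤ} (hN : Module.Finite k (N.gr j)) :
    Module.Finite k (M.gr j) :=
  Module.Finite.of_injective
    ((Hom.klin f).restrict (p := M.gr j) (q := N.gr j) fun _ hx => lin_mem f hx)
    fun _ _ h => Subtype.ext (hf (congrArg Subtype.val h))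

theorem finite_gr_of_surjective {M N : GrMod 𝒜} (f : M ⟶ N)
    (hf : Function.Surjective (Hom.lin f)) {j : ℤ} (hM : Module.Finite k (M.gr j)) :
    Module.Finite k (N.gr j) :=
  Module.Finite.of_surjective
    ((Hom.klin f).restrict (p := M.gr j) (q := N.gr j) fun _ hx => lin_mem f hx)
    fun ⟨y, hy⟩ => by
      obtain ⟨x, hx, rfl⟩ := exists_lift_mem_gr f hf hy
      exact ⟨⟨x, hx⟩, rfl⟩

/-- Spanning sets over `k` of the finitely many components `M_j`, `j ∈ D`, together generate `M`
over `Λ`. This provides finite generation of syzygies and of `J^i M` without a noetherian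
hypothesis. -/
theorem GeneratedInDegrees.finite {M : GrMod 𝒜} {D : Set ℤ} (hM : M.GeneratedInDegrees D)
    (hD : D.Finite) (h : M.IsLocallyFinite) : Module.Finite A M := by
  have hfg : (⨆ j ∈ D, M.gr j).FG := by
    have : (⨆ j ∈ hD.toFinset, M.gr j).FG := Submodule.fg_biSup _ _ fun j _ =>
      Module.Finite.iff_fg.1 (h j)
    simpa using this
  obtain ⟨s, hs⟩ := hfg
  refine ⟨⟨s, eq_top_iff.2 (hM.ge.trans (Submodule.span_le.2 (Set.iUnion₂_subset fun j hj => ?_)))⟩⟩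
  have h1 : M.gr j ≤ Submodule.span k (s : Set M) := hs ▸ le_biSup M.gr hj
  exact fun x hx => Submodule.span_le_restrictScalars k A (s : Set M) (h1 hx)

end Basic

/-! ### Idempotents of `Λ₀` and homogeneous generators adapted to them -/

section Idempotents

variable {k : Type w} [Field k] {A : Type u} [Ring A] [Algebra k A] {𝒜 : ℕ → Submodule k A}

/-- A complete family of orthogonal idempotents of `Λ₀` such that each `e Λ₀` is one-dimensional. -/
structure SplitIdempotents (𝒜 : ℕ → Submodule k A) (r : ℕ) where
  e : Fin r → A
  mem : ∀ s, e s ∈ 𝒜 0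
  sum_eq : ∑ s, e s = 1
  mul_self : ∀ s, e s * e s = e s
  mul_ne : ∀ s t, s ≠ t → e s * e t = 0
  exists_smul : ∀ a ∈ 𝒜 0, ∃ c : Fin r → k, ∀ s, a * e s = c s • e s ∧ e s * a = c s • e s

/-- Homogeneous elements `x` with `e x = x` for one of the idempotents `e`. -/
def idemHomogeneous {r : ℕ} (E : SplitIdempotents 𝒜 r) (N : GrMod 𝒜) : Set N :=
  {x | ∃ j s, x ∈ N.gr j ∧ E.e s • x = x}

/-- Write `x = ∑ e_s x`; since `e_s` has degree `0`, each `e_s x` keeps the degree of `x`. -/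
theorem span_idemHomogeneous {r : ℕ} (E : SplitIdempotents 𝒜 r) (N : GrMod 𝒜) :
    Submodule.span A (idemHomogeneous E N) = ⊤ := by
  rw [eq_top_iff, ← N.span_homogeneous, Submodule.span_le]
  rintro x ⟨j, hx⟩
  rw [← one_smul A x, ← E.sum_eq, Finset.sum_smul]
  refine Submodule.sum_mem _ fun s _ => Submodule.subset_span ⟨j, s, ?_, ?_⟩
  · simpa using N.smul_mem (E.mem s) hx
  · rw [← mul_smul, E.mul_self]

theorem exists_finset_idemHomogeneous {r : ℕ} (E : SplitIdempotents 𝒜 r) (N : GrMod 𝒜)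
    [Module.Finite A N] :
    ∃ s : Finset N, (s : Set N) ⊆ idemHomogeneous E N ∧ Submodule.span A (s : Set N) = ⊤ := by
  obtain ⟨s, hs⟩ := Module.Finite.fg_top (R := A) (M := N)
  obtain ⟨t, ht, hst⟩ := Submodule.subset_span_finite_of_subset_span (R := A) (t := s)
    (s := idemHomogeneous E N) (by rw [span_idemHomogeneous]; exact fun _ _ => trivial)
  exact ⟨t, ht, top_unique (hs ▸ Submodule.span_le.2 hst)⟩

/-- The idempotents are the preimages of the standard basis vectors of `k^r`. The same scalar works
on both sides in `exists_smul` because `k^r` is commutative. -/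
theorem _root_.IsStandardlyGraded.exists_splitIdempotents
    [GradedAlgebra 𝒜] (h : IsStandardlyGraded 𝒜) : ∃ r, Nonempty (SplitIdempotents 𝒜 r) := by
  obtain ⟨r, -, ⟨φ⟩⟩ := h.degree_zero
  have hval : ∀ x y : Fin r → k, (φ.symm (x * y) : A) = φ.symm x * φ.symm y := fun x y => by
    rw [map_mul]; rfl
  refine ⟨r, ⟨fun s => φ.symm (Pi.single s 1), fun s => Subtype.prop _, ?_, fun s => ?_,
    fun s t hst => ?_, fun a ha => ⟨φ ⟨a, ha⟩, fun s => ?_⟩⟩⟩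
  · have : ∑ s, φ.symm (Pi.single s (1 : k)) = 1 := by
      rw [← map_sum, Finset.univ_sum_single (fun _ => (1 : k))]
      exact map_one _
    simpa using congrArg (Subtype.val : 𝒜 0 → A) this
  · rw [← hval, ← Pi.single_mul, one_mul]
  · rw [← hval]
    rw [show (Pi.single s (1 : k) * Pi.single t 1 : Fin r → k) = 0 by
      ext i; by_cases h : i = s <;> simp_all [Pi.single_apply]]
    simp
  · have ha' : a = (φ.symm (φ ⟨a, ha⟩) : A) := by simp
    have h1 : φ ⟨a, ha⟩ * Pi.single s 1 = φ ⟨a, ha⟩ s • (Pi.single s 1 : Fin r → k) := by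
      ext i; by_cases h : i = s <;> simp_all
    have h2 : (φ.symm (φ ⟨a, ha⟩ s • (Pi.single s 1 : Fin r → k)) : A) =
      φ ⟨a, ha⟩ s • (φ.symm (Pi.single s 1) : A) := by rw [map_smul]; rfl
    constructor
    · conv_lhs => rw [ha', ← hval, h1, h2]
    · conv_lhs => rw [ha', ← hval, mul_comm, h1, h2]

end Idempotents

/-! ### Morphisms to shifts of `Λ₀` and graded Nakayama -/

section Trivial

variable {k : Type w} [Field k] {A : Type u} [Ring A] [Algebra k A] {𝒜 : ℕ → Submodule k A}
  [GradedAlgebra 𝒜]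

/-- The inclusion of `Λ₀` into `Λ`. -/
def trivialVal (𝒜 : ℕ → Submodule k A) [GradedAlgebra 𝒜] (j : ℤ) :
    (trivialMod 𝒜).shift j →ₗ[k] A := (𝒜 0).subtype

theorem trivialVal_injective (j : ℤ) : Function.Injective (trivialVal 𝒜 j) :=
  Subtype.val_injective

theorem trivialVal_smul (j : ℤ) (a : A) (x : (trivialMod 𝒜).shift j) :
    trivialVal 𝒜 j (a • x) = GradedRing.projZeroRingHom 𝒜 a * trivialVal 𝒜 j x := rfl

theorem trivial_smul_of_pos {j : ℤ} {i : ℕ} (hi : 0 < i) {a : A} (ha : a ∈ 𝒜 i)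
    (x : (trivialMod 𝒜).shift j) : a • x = 0 := by
  apply trivialVal_injective
  rw [trivialVal_smul, GradedRing.projZeroRingHom_apply, DirectSum.decompose_of_mem_ne 𝒜 ha hi.ne',
    zero_mul, map_zero]

theorem trivialVal_smul_zero (j : ℤ) {a : A} (ha : a ∈ 𝒜 0) (x : (trivialMod 𝒜).shift j) :
    trivialVal 𝒜 j (a • x) = a * trivialVal 𝒜 j x := by
  rw [trivialVal_smul, GradedRing.projZeroRingHom_apply, DirectSum.decompose_of_mem_same 𝒜 ha]

theorem trivial_gr_self (j : ℤ) : ((trivialMod 𝒜).shift j).gr j = ⊤ := by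
  exact if_pos (sub_self j)

theorem trivial_gr_ne {i j : ℤ} (h : i ≠ j) : ((trivialMod 𝒜).shift j).gr i = ⊥ := by
  exact if_neg (sub_ne_zero.2 h)

theorem lin_trivial_of_ne {N : GrMod 𝒜} {j : ℤ} (f : N ⟶ (trivialMod 𝒜).shift j) {i : ℤ}
    (hij : i ≠ j) {x : N} (hx : x ∈ N.gr i) : Hom.lin f x = 0 := by
  have := lin_mem f hx
  rwa [trivial_gr_ne hij] at this

theorem hom_trivial_eq_zero {N : GrMod 𝒜} {j : ℤ} (h : N.gr j = ⊥)
    (f : N ⟶ (trivialMod 𝒜).shift j) : f = 0 := by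
  refine hom_ext fun x => graded_induction N.isInternal (P := fun x => Hom.lin f x = 0)
    (map_zero _) (fun x y hx hy => by rw [map_add, hx, hy, add_zero]) (fun i x hx => ?_) x
  by_cases hij : i = j
  · subst hij
    rw [h] at hx
    rw [show x = 0 from hx, map_zero]
  · exact lin_trivial_of_ne f hij hx

/-- The morphism `N ⟶ Λ₀[j]` given by `x ↦ ∑ φ (e_s x_j) e_s`, for a linear functional `φ` which
vanishes on `(J N)_j`. -/
noncomputable def toTrivial {r : ℕ} (E : SplitIdempotents 𝒜 r) {N : GrMod 𝒜} {j : ℤ}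
    (φ : N →ₗ[k] k)
    (hφ : ∀ (i : ℕ), 0 < i → ∀ a ∈ 𝒜 i, ∀ x ∈ N.gr (j - i), φ (a • x) = 0) :
    N ⟶ (trivialMod 𝒜).shift j :=
  let g : N →ₗ[k] A := ∑ s,
    (φ ∘ₗ DistribSMul.toLinearMap k N (E.e s) ∘ₗ N.proj j).smulRight (E.e s)
  have hg : ∀ x, g x = ∑ s, φ (E.e s • N.proj j x) • E.e s := fun x => by
    rw [LinearMap.sum_apply]; rfl
  let f : N →ₗ[k] (trivialMod 𝒜).shift j :=
    (LinearMap.codRestrict (𝒜 0) g fun x =>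
      hg x ▸ Submodule.sum_mem _ fun s _ => (𝒜 0).smul_mem _ (E.mem s) : N →ₗ[k] 𝒜 0)
  have hf : ∀ x, trivialVal 𝒜 j (f x) = ∑ s, φ (E.e s • N.proj j x) • E.e s := hg
  ofLin
    { toFun := f
      map_add' := map_add f
      map_smul' := fun a x => by
        refine DirectSum.Decomposition.inductionOn 𝒜 (motive := fun a => f (a • x) = a • f x)
          (by simp) (fun {i} a => ?_) (fun a b ha hb => by simp only [add_smul, map_add, ha, hb]) a
        obtain ⟨a, ha⟩ := a
        apply trivialVal_injective
        change trivialVal 𝒜 j (f (a • x)) = trivialVal 𝒜 j (a • f x)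
        rw [hf, proj_smul N ha]
        -- In degree `0`, `a` multiplies `e_s` by the same scalar from either side, so the
        -- coefficients agree. In positive degree both sides vanish: `φ` kills `(J N)_j` and `J`
        -- kills `Λ₀`.
        rcases Nat.eq_zero_or_pos i with rfl | hi
        · rw [trivialVal_smul_zero j ha, hf, Finset.mul_sum]
          obtain ⟨c, hc⟩ := E.exists_smul a ha
          refine Finset.sum_congr rfl fun s _ => ?_
          rw [mul_smul_comm, (hc s).1, ← mul_smul, (hc s).2, smul_assoc, map_smul, smul_eq_mul,
            mul_comm, mul_smul, Nat.cast_zero, sub_zero]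
        · rw [trivial_smul_of_pos hi ha, map_zero]
          refine Finset.sum_eq_zero fun s _ => ?_
          rw [← mul_smul, hφ i hi _ _ _ (proj_mem _ _ _), zero_smul]
          simpa using SetLike.mul_mem_graded (E.mem s) ha }
    fun i x hx => by
      by_cases hij : i = j
      · subst hij
        rw [trivial_gr_self]
        trivial
      · rw [trivial_gr_ne hij]
        apply trivialVal_injective
        change trivialVal 𝒜 j (f x) = _
        rw [hf, map_zero, proj_ne hij hx]
        simp

theorem trivialVal_toTrivial {r : ℕ} (E : SplitIdempotents 𝒜 r) {N : GrMod 𝒜} {j : ℤ}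
    (φ : N →ₗ[k] k) (hφ) (x : N) :
    trivialVal 𝒜 j (Hom.lin (toTrivial E φ hφ : N ⟶ (trivialMod 𝒜).shift j) x) =
      ∑ s, φ (E.e s • N.proj j x) • E.e s := by
  change (∑ s, (φ ∘ₗ DistribSMul.toLinearMap k N (E.e s) ∘ₗ N.proj j).smulRight (E.e s)) x = _
  rw [LinearMap.sum_apply]
  rfl

/-- A graded version of Nakayama's lemma: a bounded below module is generated in the degrees in
which it has a non-zero morphism to the trivial module. -/
theorem generatedInDegrees_of_hom_eq_zero {r : ℕ} (E : SplitIdempotents 𝒜 r) {N : GrMod 𝒜}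
    {a : ℤ} (hN : N.IsGE a) {D : Set ℤ}
    (h : ∀ j ∉ D, ∀ f : N ⟶ (trivialMod 𝒜).shift j, f = 0) : N.GeneratedInDegrees D := by
  set S := Submodule.span A (⋃ j ∈ D, (N.gr j : Set N)) with hS
  -- Induction upwards from the lower bound `a`: if `S` contains everything below degree `j`, it
  -- contains `(J N)_j`, so a functional vanishing on `S` defines a morphism to `Λ₀[j]`.
  suffices H : ∀ n : ℕ, ∀ j < a + n, ∀ x ∈ N.gr j, x ∈ S by
    refine eq_top_iff.2 fun x _ => ?_
    refine graded_induction N.isInternal (P := fun x => x ∈ S) (zero_mem _)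
      (fun _ _ => add_mem) (fun j x hx => H (j - a + 1).toNat j (by omega) x hx) x
  intro n
  induction n with
  | zero =>
    intro j hj x hx
    rw [hN j (by simpa using hj)] at hx
    rw [show x = 0 from hx]
    exact zero_mem _
  | succ n ih =>
    intro j hj x hx
    by_cases hjD : j ∈ D
    · exact Submodule.subset_span (Set.mem_biUnion hjD hx)
    by_contra hxS
    obtain ⟨s, hs⟩ : ∃ s, E.e s • x ∉ S := by
      by_contra! hall
      apply hxS
      rw [← one_smul A x, ← E.sum_eq, Finset.sum_smul]
      exact Submodule.sum_mem _ fun s _ => hall s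
    obtain ⟨φ, hφ0, hφ⟩ := Submodule.exists_le_ker_of_notMem (p := S.restrictScalars k) hs
    have hφS : ∀ y ∈ S, φ y = 0 := fun y hy => hφ hy
    have h0 := h j hjD (toTrivial E φ fun i hi a ha y hy =>
      hφS _ (S.smul_mem a (ih _ (by push_cast at hj; omega) y hy)))
    have h1 := trivialVal_toTrivial E φ (j := j) (fun i hi a ha y hy =>
      hφS _ (S.smul_mem a (ih _ (by push_cast at hj; omega) y hy))) x
    rw [h0, lin_zero, LinearMap.zero_apply, map_zero, proj_same hx] at h1
    -- Multiplying by `e_s` isolates the coefficient `φ(e_s x)`, which is nonzero. So `e_s = 0`,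
    -- contradicting `e_s x ∉ S`.
    have h2 := congrArg (fun b => b * E.e s) h1
    simp only [zero_mul, Finset.sum_mul, smul_mul_assoc] at h2
    rw [Finset.sum_eq_single s (fun t _ ht => by rw [E.mul_ne t s ht, smul_zero])
      (by simp), E.mul_self, eq_comm, smul_eq_zero] at h2
    rcases h2 with h2 | h2
    · exact hφ0 h2
    · rw [h2, zero_smul] at hs
      exact hs (zero_mem _)

end Trivial

end GrMod

namespace GrMod

variable {k : Type w} [Field k] {A : Type u} [Ring A] [Algebra k A] {𝒜 : ℕ → Submodule k A}

/-! ### Graded free modules -/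

/-- The components of `Λ`, indexed by `ℤ`. -/
def regularGr (𝒜 : ℕ → Submodule k A) (i : ℤ) : Submodule k A := if 0 ≤ i then 𝒜 i.toNat else ⊥

theorem regularGr_natCast (i : ℕ) : regularGr 𝒜 i = 𝒜 i := by simp [regularGr]

theorem regularGr_of_neg {i : ℤ} (hi : i < 0) : regularGr 𝒜 i = ⊥ := if_neg (by omega)

theorem smul_mem_gr {M : GrMod 𝒜} {i j : ℤ} {a : A} (ha : a ∈ regularGr 𝒜 i) {x : M}
    (hx : x ∈ M.gr j) : a • x ∈ M.gr (i + j) := by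
  unfold regularGr at ha
  split_ifs at ha with h
  · have := M.smul_mem ha hx
    rwa [Int.toNat_of_nonneg h] at this
  · rw [show a = 0 from ha, zero_smul]
    exact zero_mem _

variable {T : Type u}

/-- The components of the free module with basis `T`, the basis element `t` being in degree
`deg t`. -/
def freeGr (𝒜 : ℕ → Submodule k A) (deg : T → ℤ) (i : ℤ) : Submodule k (Π₀ _ : T, A) :=
  ⨅ t, (regularGr 𝒜 (i - deg t)).comap (DFinsupp.lapply t)

theorem mem_freeGr {deg : T → ℤ} {i : ℤ} {f : Π₀ _ : T, A} :
    f ∈ freeGr 𝒜 deg i ↔ ∀ t, f t ∈ regularGr 𝒜 (i - deg t) :=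
  Submodule.mem_iInf _

variable [GradedAlgebra 𝒜]

/-- The projection of `Λ` onto its component of degree `i ∈ ℤ`. -/
def regularProj (𝒜 : ℕ → Submodule k A) [GradedAlgebra 𝒜] (i : ℤ) : A →ₗ[k] A :=
  if 0 ≤ i then GradedAlgebra.proj 𝒜 i.toNat else 0

theorem regularProj_same {i : ℤ} {x : A} (hx : x ∈ regularGr 𝒜 i) : regularProj 𝒜 i x = x := by
  unfold regularGr at hx
  unfold regularProj
  split_ifs at hx ⊢ with h
  · exact DirectSum.decompose_of_mem_same 𝒜 hx
  · exact hx.symm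

theorem regularProj_ne {i j : ℤ} (hij : i ≠ j) {x : A} (hx : x ∈ regularGr 𝒜 i) :
    regularProj 𝒜 j x = 0 := by
  unfold regularGr at hx
  unfold regularProj
  by_cases hi : 0 ≤ i
  · rw [if_pos hi] at hx
    split_ifs with hj
    · exact DirectSum.decompose_of_mem_ne 𝒜 hx (by omega)
    · rfl
  · rw [if_neg hi] at hx
    rw [show x = 0 from hx, map_zero]

theorem iSup_regularGr : iSup (regularGr 𝒜) = ⊤ := by
  rw [eq_top_iff, ← (DirectSum.Decomposition.isInternal 𝒜).submodule_iSup_eq_top]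
  exact iSup_le fun i => (regularGr_natCast (𝒜 := 𝒜) i) ▸ le_iSup (regularGr 𝒜) (i : ℤ)

theorem regular_mul_mem {i : ℕ} {j : ℤ} {a b : A} (ha : a ∈ 𝒜 i) (hb : b ∈ regularGr 𝒜 j) :
    a * b ∈ regularGr 𝒜 (i + j) := by
  by_cases hj : 0 ≤ j
  · obtain ⟨n, rfl⟩ := Int.eq_ofNat_of_zero_le hj
    rw [regularGr_natCast] at hb
    rw [← Nat.cast_add, regularGr_natCast]
    exact SetLike.mul_mem_graded ha hb
  · rw [regularGr_of_neg (by omega)] at hb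
    rw [show b = 0 from hb, mul_zero]
    exact zero_mem _

theorem iSup_freeGr (deg : T → ℤ) : iSup (freeGr 𝒜 deg) = ⊤ := by
  classical
  refine eq_top_iff.2 fun x _ => ?_
  induction x using DFinsupp.induction with
  | h0 => exact zero_mem _
  | ha t a f _ _ ih =>
    refine add_mem ?_ (ih trivial)
    have ha : (⊤ : Submodule k A).map (DFinsupp.lsingle (M := fun _ => A) t) ≤
        iSup (freeGr 𝒜 deg) := by
      rw [← iSup_regularGr (𝒜 := 𝒜), Submodule.map_iSup]
      refine iSup_le fun i => ?_
      rintro _ ⟨b, hb, rfl⟩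
      refine Submodule.mem_iSup_of_mem (i + deg t) (mem_freeGr.2 fun t' => ?_)
      rw [DFinsupp.lsingle_apply]
      by_cases h : t = t'
      · subst h
        rw [DFinsupp.single_eq_same, add_sub_cancel_right]
        exact hb
      · rw [DFinsupp.single_eq_of_ne (Ne.symm h)]
        exact zero_mem _
    exact ha ⟨a, trivial, rfl⟩

/-- The graded free module with basis `T`, the basis element `t` being in degree `deg t`. -/
noncomputable def free (𝒜 : ℕ → Submodule k A) [GradedAlgebra 𝒜] (deg : T → ℤ) : GrMod 𝒜 where
  carrier := Π₀ _ : T, A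
  gr := freeGr 𝒜 deg
  isInternal := isInternal_of_proj _
    (fun i => DFinsupp.mapRange.linearMap fun t => regularProj 𝒜 (i - deg t))
    (fun _ _ hx => DFinsupp.ext fun t => regularProj_same (mem_freeGr.1 hx t))
    (fun _ _ hij _ hx => DFinsupp.ext fun t =>
      regularProj_ne (fun h => hij (sub_left_injective h)) (mem_freeGr.1 hx t))
    (iSup_freeGr deg)
  smul_mem {i j a m} ha hm := mem_freeGr.2 fun t => by
    rw [add_sub_assoc]
    exact regular_mul_mem ha (mem_freeGr.1 hm t)

variable {deg : T → ℤ}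

/-- The coordinate functions of a graded free module. -/
noncomputable def coord (t : T) : free 𝒜 deg →ₗ[A] A := DFinsupp.lapply t

theorem mem_free_gr {i : ℤ} {f : free 𝒜 deg} :
    f ∈ (free 𝒜 deg).gr i ↔ ∀ t, coord t f ∈ regularGr 𝒜 (i - deg t) :=
  mem_freeGr

theorem free_ext {f g : free 𝒜 deg} (h : ∀ t, coord t f = coord t g) : f = g := DFinsupp.ext h

open Classical in
/-- The basis of a graded free module. -/
noncomputable def basisElt (𝒜 : ℕ → Submodule k A) [GradedAlgebra 𝒜] (deg : T → ℤ) (t : T) :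
    free 𝒜 deg := DFinsupp.single t (1 : A)

theorem coord_basisElt_self (t : T) : coord t (basisElt 𝒜 deg t) = 1 := by
  classical exact DFinsupp.single_eq_same (β := fun _ : T => A) (i := t)

theorem coord_basisElt_ne {t t' : T} (h : t ≠ t') : coord t' (basisElt 𝒜 deg t) = 0 := by
  classical exact DFinsupp.single_eq_of_ne h.symm

theorem basisElt_mem (t : T) : basisElt 𝒜 deg t ∈ (free 𝒜 deg).gr (deg t) := by
  refine mem_free_gr.2 fun t' => ?_
  by_cases h : t = t'
  · subst h
    rw [coord_basisElt_self, sub_self, ← Nat.cast_zero, regularGr_natCast]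
    exact SetLike.one_mem_graded 𝒜
  · rw [coord_basisElt_ne h]
    exact zero_mem _

/-- A linear map out of a free module takes `f` into any additive submonoid containing the values
`f_t u(b_t)`. -/
theorem free_lin_mem {X : Type*} [AddCommGroup X] [Module A X] (u : free 𝒜 deg →ₗ[A] X)
    {σ : Type*} [SetLike σ X] [AddSubmonoidClass σ X] (S : σ) (f : free 𝒜 deg)
    (h : ∀ t, coord t f • u (basisElt 𝒜 deg t) ∈ S) : u f ∈ S := by
  classical
  have hf : f = ∑ t ∈ DFinsupp.support f, coord t f • basisElt 𝒜 deg t := by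
    conv_lhs => rw [← DFinsupp.sum_single (f := (f : Π₀ _ : T, A))]
    refine Finset.sum_congr rfl fun t _ => ?_
    refine (congrArg (DFinsupp.single t) (mul_one (coord t f)).symm).trans ?_
    exact DFinsupp.single_smul (β := fun _ : T => A) (coord t f) (1 : A)
  rw [hf, map_sum]
  exact sum_mem fun t _ => by rw [map_smul]; exact h t

theorem free_lin_ext {X : Type*} [AddCommGroup X] [Module A X] {u v : free 𝒜 deg →ₗ[A] X}
    (h : ∀ t, u (basisElt 𝒜 deg t) = v (basisElt 𝒜 deg t)) : u = v := by
  ext f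
  have : (u - v) f ∈ (⊥ : Submodule A X) := free_lin_mem _ _ f fun t => by
    rw [LinearMap.sub_apply, h, sub_self, smul_zero]
    exact zero_mem _
  exact sub_eq_zero.1 this

open Classical in
/-- The linear map out of a free module determined by the images of the basis. -/
noncomputable def freeLin {X : Type*} [AddCommGroup X] [Module A X] (y : T → X) :
    free 𝒜 deg →ₗ[A] X :=
  (DFinsupp.lsum ℕ fun t => LinearMap.toSpanSingleton A X (y t) : (Π₀ _ : T, A) →ₗ[A] X)

theorem freeLin_basisElt {X : Type*} [AddCommGroup X] [Module A X] (y : T → X) (t : T) :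
    freeLin y (basisElt 𝒜 deg t) = y t := by
  classical
  refine (DFinsupp.lsum_single ℕ (fun t => LinearMap.toSpanSingleton A X (y t)) t (1 : A)).trans ?_
  exact one_smul A (y t)

/-- The morphism out of a graded free module determined by homogeneous elements. -/
noncomputable def freeLift {X : GrMod 𝒜} (y : T → X) (hy : ∀ t, y t ∈ X.gr (deg t)) :
    free 𝒜 deg ⟶ X :=
  ofLin (freeLin y) fun i f hf => free_lin_mem (freeLin y) (X.gr i) f fun t => by
    rw [freeLin_basisElt]
    have := smul_mem_gr (mem_free_gr.1 hf t) (hy t)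
    rwa [sub_add_cancel] at this

theorem freeLift_basisElt {X : GrMod 𝒜} (y : T → X) (hy : ∀ t, y t ∈ X.gr (deg t)) (t : T) :
    Hom.lin (freeLift y hy) (basisElt 𝒜 deg t) = y t :=
  freeLin_basisElt y t

theorem free_projective : Projective (free 𝒜 deg) where
  factors {E X} f e _ := by
    have h : ∀ t, ∃ x ∈ E.gr (deg t), Hom.lin e x = Hom.lin f (basisElt 𝒜 deg t) := fun t =>
      exists_lift_mem_gr e (surjective_of_epi e) (lin_mem f (basisElt_mem t))
    choose y hy hey using h
    refine ⟨freeLift y hy, Subtype.ext (free_lin_ext fun t => ?_)⟩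
    exact (congrArg (Hom.lin e) (freeLift_basisElt y hy t)).trans (hey t)

theorem free_isGE {a : ℤ} (h : ∀ t, a ≤ deg t) : (free 𝒜 deg).IsGE a := fun j hj => by
  rw [eq_bot_iff]
  intro f hf
  refine free_ext fun t => ?_
  have := mem_free_gr.1 hf t
  rw [regularGr_of_neg (by have := h t; omega)] at this
  rw [show coord t f = 0 from this, map_zero]

theorem free_isLocallyFinite [Finite T] (h : ∀ i, Module.Finite k (𝒜 i)) :
    (free 𝒜 deg).IsLocallyFinite := fun j => by
  have : ∀ i, Module.Finite k (regularGr 𝒜 i) := fun i => by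
    by_cases hi : 0 ≤ i
    · rw [show regularGr 𝒜 i = 𝒜 i.toNat from if_pos hi]
      exact h _
    · rw [regularGr_of_neg (not_le.1 hi)]
      infer_instance
  let u : (free 𝒜 deg).gr j →ₗ[k] ∀ t, regularGr 𝒜 (j - deg t) :=
    LinearMap.pi fun t => ((coord t).restrictScalars k).restrict fun f hf => mem_free_gr.1 hf t
  refine Module.Finite.of_injective u fun f g hfg => Subtype.ext (free_ext fun t => ?_)
  exact congrArg Subtype.val (congrFun hfg t)

theorem free_finite [Finite T] : Module.Finite A (free 𝒜 deg) := by
  refine ⟨(Submodule.fg_def).2 ⟨Set.range (basisElt 𝒜 deg), Set.finite_range _, ?_⟩⟩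
  refine eq_top_iff.2 fun f _ => ?_
  exact free_lin_mem LinearMap.id _ f fun t =>
    Submodule.smul_mem _ _ (Submodule.subset_span ⟨t, rfl⟩)

theorem freeLift_surjective {X : GrMod 𝒜} {y : T → X} (hy : ∀ t, y t ∈ X.gr (deg t))
    (h : Submodule.span A (Set.range y) = ⊤) : Function.Surjective (Hom.lin (freeLift y hy)) := by
  rw [← LinearMap.range_eq_top, eq_top_iff, ← h, Submodule.span_le]
  rintro _ ⟨t, rfl⟩
  exact ⟨_, freeLift_basisElt y hy t⟩

/-- Every graded module is a quotient of a graded free module with the same lower bounds. -/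
theorem exists_projective_cover_isGE (N : GrMod 𝒜) : ∃ (P : GrMod 𝒜) (f : P ⟶ N),
    Projective P ∧ Function.Surjective (Hom.lin f) ∧ ∀ a, N.IsGE a → P.IsGE a := by
  let T := {x : Σ j, N.gr j // x.2 ≠ 0}
  let deg : T → ℤ := fun t => t.1.1
  refine ⟨free 𝒜 deg, freeLift (fun t => (t.1.2 : N)) fun t => t.1.2.2, free_projective,
    freeLift_surjective _ ?_, fun a ha => free_isGE fun t => ?_⟩
  · rw [eq_top_iff, ← N.span_homogeneous, Submodule.span_le]
    rintro x ⟨j, hx⟩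
    by_cases h0 : x = 0
    · rw [h0]
      exact zero_mem _
    · exact Submodule.subset_span ⟨⟨⟨j, x, hx⟩, fun h => h0 (congrArg Subtype.val h)⟩, rfl⟩
  · by_contra! h
    refine t.2 (Subtype.ext ?_)
    exact (ha _ h).le t.1.2.2

/-! ### Finitely generated graded modules and projective covers -/

section FreeIdem

variable {r : ℕ} (E : SplitIdempotents 𝒜 r) (deg : T → ℤ) (ε : T → Fin r)

/-- The idempotent endomorphism `b_t ↦ e_t b_t` of a graded free module. -/
noncomputable def idemEnd : free 𝒜 deg ⟶ free 𝒜 deg :=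
  freeLift (fun t => E.e (ε t) • basisElt 𝒜 deg t) fun t => by
    simpa using (free 𝒜 deg).smul_mem (E.mem (ε t)) (basisElt_mem t)

/-- The graded projective module `⨁ Λ e_t`, with `e_t` in degree `deg t`. -/
noncomputable def freeIdem : GrMod 𝒜 :=
  (free 𝒜 deg).sub (LinearMap.range (Hom.lin (idemEnd E deg ε))) (isGradedSub_range _)

/-- The inclusion of `⨁ Λ e_t` into the free module. -/
noncomputable def freeIdemι : freeIdem E deg ε ⟶ free 𝒜 deg := subι _ _ _

/-- The projection of the free module onto `⨁ Λ e_t`. -/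
noncomputable def freeIdemπ : free 𝒜 deg ⟶ freeIdem E deg ε :=
  ofLin (LinearMap.rangeRestrict (Hom.lin (idemEnd E deg ε))) fun _ _ hx =>
    lin_mem (idemEnd E deg ε) hx

theorem freeIdemπ_surjective : Function.Surjective (Hom.lin (freeIdemπ E deg ε)) :=
  LinearMap.surjective_rangeRestrict _

theorem idemEnd_idem (f : free 𝒜 deg) :
    Hom.lin (idemEnd E deg ε) (Hom.lin (idemEnd E deg ε) f) = Hom.lin (idemEnd E deg ε) f := by
  refine LinearMap.congr_fun (free_lin_ext (u := Hom.lin (idemEnd E deg ε) ∘ₗ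
    Hom.lin (idemEnd E deg ε)) (v := Hom.lin (idemEnd E deg ε)) fun t => ?_) f
  have h : Hom.lin (idemEnd E deg ε) (basisElt 𝒜 deg t) = E.e (ε t) • basisElt 𝒜 deg t :=
    freeLift_basisElt _ _ t
  rw [LinearMap.comp_apply, h, map_smul, h, ← mul_smul, E.mul_self]

theorem freeIdemι_π : freeIdemι E deg ε ≫ freeIdemπ E deg ε = 𝟙 _ := by
  refine hom_ext fun x => Subtype.ext ?_
  obtain ⟨_, ⟨f, rfl⟩⟩ := x
  exact idemEnd_idem E deg ε f

theorem freeIdem_projective : Projective (freeIdem E deg ε) :=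
  have := free_projective (𝒜 := 𝒜) (deg := deg)
  Retract.projective ⟨freeIdemι E deg ε, freeIdemπ E deg ε, freeIdemι_π E deg ε⟩

theorem coord_idemEnd (f : free 𝒜 deg) (t : T) :
    coord t (Hom.lin (idemEnd E deg ε) f) = coord t f * E.e (ε t) := by
  refine LinearMap.congr_fun (free_lin_ext (u := coord t ∘ₗ Hom.lin (idemEnd E deg ε))
    (v := LinearMap.toSpanSingleton A A (E.e (ε t)) ∘ₗ coord t) fun t' => ?_) f
  have h : Hom.lin (idemEnd E deg ε) (basisElt 𝒜 deg t') = E.e (ε t') • basisElt 𝒜 deg t' :=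
    freeLift_basisElt _ _ t'
  rw [LinearMap.comp_apply, h, map_smul, LinearMap.comp_apply, LinearMap.toSpanSingleton_apply]
  by_cases ht : t' = t
  · subst ht
    rw [coord_basisElt_self, one_smul, smul_eq_mul, mul_one]
  · rw [coord_basisElt_ne ht, smul_zero, zero_smul]

/-- The idempotent endomorphism is right multiplication by `e_t` on the coordinate `t`, so
coordinates of its image lie in `Λ e_t`. In degree `0` this leaves only scalar multiples of `e_t`,
as needed for the minimality argument in `exists_projective_cover`. -/
theorem coord_freeIdemι (x : freeIdem E deg ε) (t : T) :
    coord t (Hom.lin (freeIdemι E deg ε) x) * E.e (ε t) =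
      coord t (Hom.lin (freeIdemι E deg ε) x) := by
  rw [← coord_idemEnd]
  exact congrArg (fun y => coord t (Hom.lin (freeIdemι E deg ε) y))
    (LinearMap.congr_fun (congrArg Hom.lin (freeIdemι_π E deg ε)) x)

end FreeIdem

/-- Both properties pass to quotients and hold for a graded free module of finite rank. -/
theorem bounded_locallyFinite_of_finite (h : IsStandardlyGraded 𝒜) (N : GrMod 𝒜)
    [Module.Finite A N] : (∃ a, N.IsGE a) ∧ N.IsLocallyFinite := by
  obtain ⟨r, ⟨E⟩⟩ := h.exists_splitIdempotents
  obtain ⟨s, hs, hspan⟩ := exists_finset_idemHomogeneous E N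
  choose deg ε hdeg hε using fun t : s => hs t.2
  have hsurj := freeLift_surjective (𝒜 := 𝒜) (T := s) (deg := deg) (X := N)
    (y := Subtype.val) hdeg (by simpa using hspan)
  obtain ⟨a, ha⟩ := (Set.finite_range deg).bddBelow
  exact ⟨⟨a, IsGE.of_surjective (free_isGE fun t => ha ⟨t, rfl⟩) _ hsurj⟩, fun j =>
    finite_gr_of_surjective _ hsurj (free_isLocallyFinite h.finite j)⟩

/-- A finitely generated graded module has a projective cover: a surjection from a finitely
generated graded projective `P` whose kernel is annihilated by all morphisms from `P` to shifts of
the trivial module. -/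
theorem exists_projective_cover {r : ℕ} (E : SplitIdempotents 𝒜 r) (N : GrMod 𝒜)
    [Module.Finite A N] : ∃ (P : GrMod 𝒜) (f : P ⟶ N), Projective P ∧ Module.Finite A P ∧
      Function.Surjective (Hom.lin f) ∧ ∀ (j : ℤ) (g : P ⟶ (trivialMod 𝒜).shift j),
        (kernelSeq f).f ≫ g = 0 := by
  classical
  -- Take a generating set of least cardinality among those made of homogeneous elements fixed by
  -- some `e_s`. Then no generator is redundant.
  have hex : ∃ n : ℕ, ∃ s : Finset N, s.card = n ∧ (s : Set N) ⊆ idemHomogeneous E N ∧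
      Submodule.span A (s : Set N) = ⊤ := by
    obtain ⟨s, hs⟩ := exists_finset_idemHomogeneous E N
    exact ⟨_, s, rfl, hs⟩
  obtain ⟨s, hcard, hs, hspan⟩ := Nat.find_spec hex
  have hmin : ∀ x ∈ s, x ∉ Submodule.span A ((s.erase x : Finset N) : Set N) := by
    intro x hx hmem
    refine Nat.find_min hex (m := (s.erase x).card) ?_ ⟨s.erase x, rfl, ?_, ?_⟩
    · rw [← hcard]
      exact Finset.card_erase_lt_of_mem hx
    · exact fun y hy => hs (Finset.mem_of_mem_erase hy)
    · rw [eq_top_iff, ← hspan, Submodule.span_le]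
      intro y hy
      by_cases hyx : y = x
      · exact hyx ▸ hmem
      · exact Submodule.subset_span (Finset.mem_erase.2 ⟨hyx, hy⟩)
  choose dg ep hdeg hε using fun t : s => hs t.2
  let π : free 𝒜 dg ⟶ N := freeLift Subtype.val hdeg
  have hπ : ∀ t, Hom.lin π (basisElt 𝒜 dg t) = t := fun t => freeLift_basisElt _ _ t
  have hπρ : idemEnd E dg ep ≫ π = π := Subtype.ext (free_lin_ext fun t => by
    change Hom.lin π (Hom.lin (idemEnd E dg ep) (basisElt 𝒜 dg t)) = Hom.lin π _
    rw [show Hom.lin (idemEnd E dg ep) (basisElt 𝒜 dg t) = E.e (ep t) • basisElt 𝒜 dg t from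
      freeLift_basisElt _ _ t, map_smul, hπ]
    exact hε t)
  have hsurj : Function.Surjective (Hom.lin π) := freeLift_surjective _ (by simpa using hspan)
  refine ⟨freeIdem E dg ep, freeIdemι E dg ep ≫ π, freeIdem_projective E dg ep, ?_, ?_, ?_⟩
  · have := free_finite (𝒜 := 𝒜) (deg := dg)
    exact Module.Finite.of_surjective _ (freeIdemπ_surjective E dg ep)
  · intro y
    obtain ⟨x, rfl⟩ := hsurj y
    exact ⟨Hom.lin (freeIdemπ E dg ep) x, LinearMap.congr_fun (congrArg Hom.lin hπρ) x⟩
  · intro j g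
    refine hom_ext fun x => graded_induction (GrMod.isInternal _)
      (P := fun x => Hom.lin ((kernelSeq (freeIdemι E dg ep ≫ π)).f ≫ g) x = 0) (map_zero _)
      (fun x y hx hy => by rw [map_add, hx, hy, add_zero]) (fun i x hx => ?_) x
    by_cases hij : i = j
    swap
    · exact lin_trivial_of_ne _ hij hx
    subst hij
    obtain ⟨x, hxker⟩ := x
    change Hom.lin g x = 0
    set f : free 𝒜 dg := Hom.lin (freeIdemι E dg ep) x with hf
    have hf0 : Hom.lin π f = 0 := hxker
    have hfi : f ∈ (free 𝒜 dg).gr i := hx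
    have hgx : Hom.lin g x = (Hom.lin g ∘ₗ Hom.lin (freeIdemπ E dg ep)) f :=
      congrArg (Hom.lin g) (LinearMap.congr_fun (congrArg Hom.lin (freeIdemι_π E dg ep)) x).symm
    rw [hgx, ← Submodule.mem_bot A]
    refine free_lin_mem _ _ f fun t => (Submodule.mem_bot A).2 ?_
    have hft := mem_free_gr.1 hfi t
    -- The coordinate at `t` has degree `i - dg t`. If negative, it is zero. If positive, it kills
    -- `Λ₀`. If zero, it is `c e_t`, and `c ≠ 0` would let the relation `π f = 0` express the
    -- generator `t` through the others.
    rcases lt_trichotomy (i - dg t) 0 with hlt | heq | hgt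
    · rw [regularGr_of_neg hlt] at hft
      rw [show coord t f = 0 from hft, zero_smul]
    · suffices coord t f = 0 by rw [this, zero_smul]
      rw [heq, ← Nat.cast_zero, regularGr_natCast] at hft
      obtain ⟨c, hc⟩ := E.exists_smul _ hft
      have hcoord : coord t f = c (ep t) • E.e (ep t) :=
        (coord_freeIdemι E dg ep x t).symm.trans (hc (ep t)).1
      by_contra hne
      have hc0 : c (ep t) ≠ 0 := fun h => hne (by rw [hcoord, h, zero_smul])
      refine hmin t t.2 ?_
      set S := Submodule.span A ((s.erase (t : N) : Finset N) : Set N)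
      have h1 : Hom.lin π (f - coord t f • basisElt 𝒜 dg t) ∈ S := by
        refine free_lin_mem _ _ _ fun t' => ?_
        by_cases htt : t = t'
        · subst htt
          rw [map_sub, map_smul, coord_basisElt_self, smul_eq_mul, mul_one, sub_self, zero_smul]
          exact zero_mem _
        · rw [hπ]
          exact S.smul_mem _ (Submodule.subset_span
            (Finset.mem_erase.2 ⟨fun h => htt (Subtype.ext h.symm), t'.2⟩))
      rw [map_sub, hf0, zero_sub, neg_mem_iff, map_smul, hπ, hcoord, smul_assoc] at h1
      have h2 : E.e (ep t) • (t : N) = t := hε t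
      rw [h2] at h1
      have h3 := (S.restrictScalars k).smul_mem (c (ep t))⁻¹ h1
      rwa [smul_smul, inv_mul_cancel₀ hc0, one_smul] at h3
    · obtain ⟨n, hn⟩ := Int.eq_ofNat_of_zero_le hgt.le
      rw [hn] at hft
      rw [regularGr_natCast] at hft
      exact trivial_smul_of_pos (by omega) hft _

end GrMod

namespace GrMod

section Shift

variable {k : Type w} [Field k] {A : Type u} [Ring A] [Algebra k A] {𝒜 : ℕ → Submodule k A}

/-! ### Shifts and extension groups -/

/-- The shift of a morphism. -/
def shiftHom {M N : GrMod 𝒜} (a : ℤ) (f : M ⟶ N) : M.shift a ⟶ N.shift a :=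
  ofLin (M := M.shift a) (N := N.shift a) (Hom.lin f :) fun _ _ hm => lin_mem f hm

/-- Shifting a morphism back. -/
def unshiftHom {M N : GrMod 𝒜} (a : ℤ) (f : M.shift a ⟶ N.shift a) : M ⟶ N :=
  ofLin (M := M) (N := N) (Hom.lin f :) fun i m hm => by
    have h1 : m ∈ (M.shift a).gr (i + a) := by
      change m ∈ M.gr (i + a - a)
      rwa [add_sub_cancel_right]
    have h2 : Hom.lin f m ∈ N.gr (i + a - a) := lin_mem f h1
    rwa [add_sub_cancel_right] at h2

theorem shift_shift (M : GrMod 𝒜) (a b : ℤ) : (M.shift a).shift b = M.shift (a + b) := by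
  have h : (fun i => M.gr (i - b - a)) = fun i => M.gr (i - (a + b)) := by
    funext i
    congr 1
    ring
  unfold shift
  congr 1

/-- A lifting problem out of `P[a]` becomes, after shifting its target by `-a`, a lifting problem
out of `P`. -/
theorem shift_projective (P : GrMod 𝒜) [Projective P] (a : ℤ) : Projective (P.shift a) where
  factors {E X} f e _ := by
    let f' : P ⟶ X.shift (-a) := ofLin (M := P) (N := X.shift (-a)) (Hom.lin f :) fun i m hm => by
      change Hom.lin f m ∈ X.gr (i - -a)
      refine lin_mem f (?_ : m ∈ P.gr (i - -a - a))
      rwa [sub_neg_eq_add, add_sub_cancel_right]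
    have := epi_of_surjective (f := shiftHom (-a) e) (surjective_of_epi e)
    let g : P ⟶ E.shift (-a) := Projective.factorThru f' (shiftHom (-a) e)
    refine ⟨ofLin (M := P.shift a) (N := E) (Hom.lin g :) fun i m hm => ?_, hom_ext fun x => ?_⟩
    · have : Hom.lin g m ∈ E.gr (i - a - -a) := lin_mem g hm
      rwa [sub_sub, add_neg_cancel, sub_zero] at this
    · exact LinearMap.congr_fun (congrArg Hom.lin (Projective.factorThru_comp f' (shiftHom (-a) e))) x

theorem HasResolutionInDegrees.finite {N : GrMod 𝒜} {D : ℕ → Set ℤ}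
    (hN : N.HasResolutionInDegrees D) : Module.Finite A N := by
  obtain ⟨R, hR⟩ := hN
  have := (hR 0).1
  exact Module.Finite.of_surjective (Hom.lin (R.π.f 0)) (surjective_of_epi (R.π.f 0))

variable [GradedAlgebra 𝒜]

/-- Only vanishing is transported, so dimension shifting along a projective presentation and its
shift suffices. -/
theorem subsingleton_ext_shift {M Y : GrMod 𝒜} (a : ℤ) {n : ℕ}
    (h : Subsingleton (Abelian.Ext M Y n)) :
    Subsingleton (Abelian.Ext (M.shift a) (Y.shift a) n) := by
  induction n generalizing M with
  | zero =>
    rw [Abelian.Ext.subsingleton_zero_iff] at h ⊢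
    exact fun f => hom_ext fun x => LinearMap.congr_fun (congrArg Hom.lin (h (unshiftHom a f))) x
  | succ n ih =>
    obtain ⟨P, f, hP, hf, -⟩ := exists_projective_cover_isGE M
    have hS := kernelSeq_shortExact hf
    let S' : ShortComplex (GrMod 𝒜) := ShortComplex.mk (shiftHom a (kernelSeq f).f) (shiftHom a f)
      (hom_ext fun x => x.2)
    have hS' : S'.ShortExact := shortExact_of_lin Subtype.val_injective hf
      fun x hx => ⟨⟨x, hx⟩, rfl⟩
    have hP' : Projective S'.X₂ := shift_projective P a
    -- `Ext¹` is separate: its vanishing does not make `Hom` from the kernel zero, but only makes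
    -- every such morphism extend to `P`.
    rcases Nat.eq_zero_or_pos n with rfl | hn
    · refine Abelian.Ext.subsingleton_one_of_extension hS' fun g => ?_
      obtain ⟨g', hg'⟩ := Abelian.Ext.exists_extension hS h (unshiftHom a g)
      exact ⟨shiftHom a g', hom_ext fun x => LinearMap.congr_fun (congrArg Hom.lin hg') x⟩
    · obtain ⟨n, rfl⟩ := Nat.exists_eq_succ_of_ne_zero hn.ne'
      exact Abelian.Ext.subsingleton_X₃ hS'
        (ih (Abelian.Ext.subsingleton_X₁ hS (Abelian.Ext.subsingleton_of_projective P _ _) h))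
        (Abelian.Ext.subsingleton_of_projective _ _ _)

end Shift

section Vanishing

variable {k : Type w} [Field k] {A : Type u} [Ring A] [Algebra k A] {𝒜 : ℕ → Submodule k A}
  [GradedAlgebra 𝒜]

/-! ### Vanishing of extension groups with values in shifts of the trivial module -/

/-- `Ext^m(N, Λ₀[j]) = 0`. -/
abbrev ExtTrivialVanishes (N : GrMod 𝒜) (m : ℕ) (j : ℤ) : Prop :=
  Subsingleton (Abelian.Ext N ((trivialMod 𝒜).shift j) m)

/-- A projective presentation can be chosen with the same lower bound, so all syzygies stay in
degrees `≥ a` and have no nonzero morphism to `Λ₀[j]` with `j < a`. -/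
theorem IsGE.extTrivialVanishes {N : GrMod 𝒜} {a j : ℤ} (hN : N.IsGE a) (hj : j < a) (m : ℕ) :
    N.ExtTrivialVanishes m j := by
  induction m generalizing N with
  | zero => exact Abelian.Ext.subsingleton_zero_iff.2 (hom_trivial_eq_zero (hN j hj))
  | succ m ih =>
    obtain ⟨P, f, hP, hf, hb⟩ := exists_projective_cover_isGE N
    exact Abelian.Ext.subsingleton_X₃ (kernelSeq_shortExact hf)
      (ih (IsGE.of_injective (hb a hN) (kernelSeq f).f Subtype.val_injective))
      (Abelian.Ext.subsingleton_of_projective P _ _)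

theorem ExtTrivialVanishes.shift {N : GrMod 𝒜} {m : ℕ} {j : ℤ} (h : N.ExtTrivialVanishes m j)
    (a : ℤ) : (N.shift a).ExtTrivialVanishes m (j + a) := by
  unfold ExtTrivialVanishes
  rw [← shift_shift]
  exact subsingleton_ext_shift a h

theorem GeneratedInDegrees.hom_trivial_eq_zero {N : GrMod 𝒜} {D : Set ℤ}
    (hN : N.GeneratedInDegrees D) {j : ℤ} (hj : j ∉ D) (f : N ⟶ (trivialMod 𝒜).shift j) :
    f = 0 := by
  refine Subtype.ext (LinearMap.ext_on hN ?_)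
  intro x hx
  obtain ⟨i, hi, hx⟩ := Set.mem_iUnion₂.1 hx
  exact lin_trivial_of_ne f (fun h => hj (h ▸ hi)) hx

theorem HasResolutionInDegrees.extTrivialVanishes {N : GrMod 𝒜} {D : ℕ → Set ℤ}
    (hN : N.HasResolutionInDegrees D) {m : ℕ} {j : ℤ} (hj : j ∉ D m) :
    N.ExtTrivialVanishes m j := by
  obtain ⟨R, hR⟩ := hN
  exact Abelian.Ext.subsingleton_of_projectiveResolution R
    ((hR m).2.hom_trivial_eq_zero hj)

/-- The morphism `Λ₀[b] ⟶ N` given by an element of degree `b` annihilated by `J`. -/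
noncomputable def ofTrivial {N : GrMod 𝒜} {b : ℤ} (z : N) (hz : z ∈ N.gr b)
    (h : ∀ i : ℕ, 0 < i → ∀ a ∈ 𝒜 i, a • z = 0) : (trivialMod 𝒜).shift b ⟶ N :=
  ofLin (M := (trivialMod 𝒜).shift b)
    { toFun := fun x => trivialVal 𝒜 b x • z
      map_add' := fun x y => by rw [map_add, add_smul]
      map_smul' := fun a x => by
        refine DirectSum.Decomposition.inductionOn 𝒜
          (motive := fun a => trivialVal 𝒜 b (a • x) • z = a • trivialVal 𝒜 b x • z)
          (by simp) (fun {i} a => ?_)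
          (fun a b ha hb => by simp only [add_smul, map_add, ha, hb]) a
        obtain ⟨a, ha⟩ := a
        have hx : trivialVal 𝒜 b x ∈ 𝒜 0 := Subtype.prop (p := fun y => y ∈ 𝒜 0) x
        change trivialVal 𝒜 b (a • x) • z = a • trivialVal 𝒜 b x • z
        rcases Nat.eq_zero_or_pos i with rfl | hi
        · rw [trivialVal_smul_zero b ha, mul_smul]
        · rw [trivial_smul_of_pos hi ha, map_zero, zero_smul, ← mul_smul, h i hi]
          simpa using SetLike.mul_mem_graded ha hx }
    fun i x hx => by
      by_cases hi : i = b
      · subst hi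
        have hx : trivialVal 𝒜 i x ∈ 𝒜 0 := Subtype.prop (p := fun y => y ∈ 𝒜 0) x
        have := N.smul_mem hx hz
        rwa [Nat.cast_zero, zero_add] at this
      · rw [trivial_gr_ne hi] at hx
        obtain rfl : x = 0 := hx
        rw [map_zero]
        exact zero_mem _

theorem ofTrivial_apply {N : GrMod 𝒜} {b : ℤ} (z : N) (hz : z ∈ N.gr b) (h)
    (x : (trivialMod 𝒜).shift b) :
    Hom.lin (ofTrivial z hz h) x = trivialVal 𝒜 b x • z := rfl

/-- A finite-dimensional module concentrated in degree `b` has the extension groups of a `d`-Koszul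
module generated in degree `b`. -/
theorem extTrivialVanishes_of_concentrated {d : ℕ} (hA : IsDKoszulAlgebra 𝒜 d) {Z : GrMod 𝒜}
    {b : ℤ} (hZ : ∀ j, j ≠ b → Z.gr j = ⊥) (hfin : Module.Finite k (Z.gr b)) {m : ℕ} {j : ℤ}
    (hj : j ≠ b + delta d m) : Z.ExtTrivialVanishes m j := by
  obtain ⟨r, ⟨E⟩⟩ := hA.isStandardlyGraded.exists_splitIdempotents
  have htop : Z.gr b = ⊤ := by
    rw [eq_top_iff, ← Z.isInternal.submodule_iSup_eq_top]
    refine iSup_le fun i => ?_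
    by_cases hi : i = b
    · rw [hi]
    · rw [hZ i hi]
      exact bot_le
  have hmem : ∀ z : Z, z ∈ Z.gr b := fun z => htop ▸ trivial
  have hpos : ∀ i : ℕ, 0 < i → ∀ a ∈ 𝒜 i, ∀ z : Z, a • z = 0 := fun i hi a ha z => by
    have := Z.smul_mem ha (hmem z)
    rwa [hZ _ (by omega)] at this
  have hfin' : Module.Finite k Z := by
    rw [htop] at hfin
    exact Module.Finite.equiv (Submodule.topEquiv (R := k) (M := Z))
  let B := Module.finBasis k Z
  have hφ : ∀ t, ∀ i : ℕ, 0 < i → ∀ a ∈ 𝒜 i, ∀ x ∈ Z.gr (b - i), B.coord t (a • x) = 0 :=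
    fun t i hi a ha x _ => by rw [hpos i hi a ha, map_zero]
  have hΛ : ((trivialMod 𝒜).shift b).ExtTrivialVanishes m j := by
    have h1 : (trivialMod 𝒜).ExtTrivialVanishes m (j - b) :=
      hA.isDKoszul.extTrivialVanishes fun h => hj (by
        have : j - b = delta d m := h
        omega)
    have h2 := h1.shift b
    rwa [sub_add_cancel] at h2
  -- With `p_t(x) = ∑_s B_t^*(e_s x) e_s` and `q_t(λ) = λ B_t`, the sum of the composites sends `x`
  -- to `∑_s e_s ∑_t B_t^*(e_s x) B_t = ∑_s e_s e_s x = x`. So `Z` is a summand of finitely many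
  -- copies of `Λ₀[b]`.
  let q := fun t => ofTrivial (B t) (hmem (B t)) fun i hi a ha => hpos i hi a ha (B t)
  refine Abelian.Ext.subsingleton_of_sum_comp Finset.univ (fun t => toTrivial E (B.coord t) (hφ t))
    q ?_ hΛ
  refine hom_ext fun x => ?_
  let linHom : (Z ⟶ Z) →+ (Z →ₗ[A] Z) := ⟨⟨Hom.lin, lin_zero⟩, lin_add⟩
  change x = linHom _ x
  rw [map_sum, LinearMap.sum_apply]
  change x = ∑ t, Hom.lin (q t) (Hom.lin (toTrivial E (B.coord t) (hφ t)) x)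
  simp only [q, ofTrivial_apply, trivialVal_toTrivial, proj_same (hmem x), Finset.sum_smul]
  rw [Finset.sum_comm]
  have h1 : ∀ s, ∑ t, (B.coord t (E.e s • x) • E.e s) • B t = E.e s • x := fun s => by
    have h2 : ∀ t, (B.coord t (E.e s • x) • E.e s) • B t =
        E.e s • (B.repr (E.e s • x) t • B t) := fun t => by
      rw [smul_assoc, smul_comm]
      rfl
    simp only [h2]
    rw [← Finset.smul_sum, B.sum_repr, ← mul_smul, E.mul_self]
  simp only [h1]
  rw [← Finset.sum_smul, E.sum_eq, one_smul]

end Vanishing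

section Truncation

variable {k : Type w} [Field k] {A : Type u} [Ring A] [Algebra k A] {𝒜 : ℕ → Submodule k A}
  [GradedAlgebra 𝒜]

/-! ### Truncations -/

/-- The submodule `⨁_{j ≥ b} N_j`. -/
def geSub (N : GrMod 𝒜) (b : ℤ) : Submodule A N where
  carrier := {x | ∀ j < b, N.proj j x = 0}
  add_mem' hx hy j hj := by rw [map_add, hx j hj, hy j hj, add_zero]
  zero_mem' j _ := map_zero _
  smul_mem' a x hx j hj := by
    refine DirectSum.Decomposition.inductionOn 𝒜 (motive := fun a => N.proj j (a • x) = 0)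
      (by simp) (fun {i} a => ?_) (fun a b ha hb => by rw [add_smul, map_add, ha, hb, add_zero]) a
    rw [proj_smul N a.2, hx _ (by omega), smul_zero]

theorem mem_geSub_of_le {N : GrMod 𝒜} {b j : ℤ} (hj : b ≤ j) {x : N} (hx : x ∈ N.gr j) :
    x ∈ N.geSub b := fun _ hi => proj_ne (by omega) hx

theorem isGradedSub_geSub (N : GrMod 𝒜) (b : ℤ) : N.IsGradedSub (N.geSub b) := by
  intro i x hx
  by_cases hi : i < b
  · rw [hx i hi]
    exact zero_mem _
  · exact mem_geSub_of_le (not_lt.1 hi) (proj_mem _ _ _)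

theorem geSub_succ_le (N : GrMod 𝒜) (b : ℤ) : N.geSub (b + 1) ≤ N.geSub b :=
  fun _ hx j hj => hx j (by omega)

/-- The truncation `N_{≥ b}`. -/
def trunc (N : GrMod 𝒜) (b : ℤ) : GrMod 𝒜 := N.sub (N.geSub b) (N.isGradedSub_geSub b)

theorem trunc_isGE (N : GrMod 𝒜) (b : ℤ) : (N.trunc b).IsGE b := fun j hj => by
  rw [eq_bot_iff]
  intro x hx
  exact Subtype.ext ((proj_same (show x.1 ∈ N.gr j from hx)).symm.trans (x.2 j hj))

theorem IsLocallyFinite.trunc {N : GrMod 𝒜} (hN : N.IsLocallyFinite) (b : ℤ) :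
    (N.trunc b).IsLocallyFinite := fun j =>
  finite_gr_of_injective (subι N (N.geSub b) (N.isGradedSub_geSub b)) Subtype.val_injective (hN j)

/-- The inclusion `N_{≥ b+1} ⟶ N_{≥ b}`. -/
def truncι (N : GrMod 𝒜) (b : ℤ) : N.trunc (b + 1) ⟶ N.trunc b :=
  ofLin (M := N.trunc (b + 1)) (N := N.trunc b) (Submodule.inclusion (N.geSub_succ_le b))
    fun _ _ hm => hm

/-- The short exact sequence `0 → N_{≥ b+1} → N_{≥ b} → N_b → 0`. -/
def truncSeq (N : GrMod 𝒜) (b : ℤ) : ShortComplex (GrMod 𝒜) := cokernelSeq (N.truncι b)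

theorem truncSeq_shortExact (N : GrMod 𝒜) (b : ℤ) : (N.truncSeq b).ShortExact :=
  cokernelSeq_shortExact (Submodule.inclusion_injective (N.geSub_succ_le b))

theorem truncSeq_X₃_gr (N : GrMod 𝒜) (b j : ℤ) (hj : j ≠ b) : (N.truncSeq b).X₃.gr j = ⊥ := by
  rw [eq_bot_iff]
  rintro _ ⟨x, hx, rfl⟩
  have hx' : x.1 ∈ N.gr j := hx
  rcases lt_or_gt_of_ne hj with h | h
  · rw [trunc_isGE N b j h] at hx
    rw [show x = 0 from hx, map_zero]
    exact zero_mem _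
  · exact (Submodule.Quotient.mk_eq_zero _).2
      ⟨⟨x.1, mem_geSub_of_le (show b + 1 ≤ j by omega) hx'⟩, rfl⟩

theorem truncSeq_X₃_extTrivialVanishes {d : ℕ} (hA : IsDKoszulAlgebra 𝒜 d) {N : GrMod 𝒜}
    (hN : N.IsLocallyFinite) (b : ℤ) {m : ℕ} {j : ℤ} (hj : j ≠ b + delta d m) :
    (N.truncSeq b).X₃.ExtTrivialVanishes m j :=
  extTrivialVanishes_of_concentrated hA (N.truncSeq_X₃_gr b)
    (finite_gr_of_surjective (N.truncSeq b).g (Submodule.mkQ_surjective _) (hN.trunc b b)) hj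

/-- Descending induction on `b`: once `b > j` the lower bound gives vanishing. Lowering `b` by one
adds the layer `N_b`, which contributes only at `j = b + δ(m)`, outside the assumed range. -/
theorem trunc_extTrivialVanishes {d : ℕ} (hA : IsDKoszulAlgebra 𝒜 d) {N : GrMod 𝒜}
    (hN : N.IsLocallyFinite) {b : ℤ} {m : ℕ} {j : ℤ} (hj : j < b + delta d m) :
    (N.trunc b).ExtTrivialVanishes m j := by
  suffices H : ∀ (n : ℕ) (b : ℤ), j < b + n → j < b + delta d m →
      (N.trunc b).ExtTrivialVanishes m j from H (j - b + 1).toNat b (by omega) hj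
  intro n
  induction n with
  | zero => exact fun b hb _ => (N.trunc_isGE b).extTrivialVanishes (by simpa using hb) m
  | succ n ih =>
    intro b hb hb'
    exact Abelian.Ext.subsingleton_X₂ (N.truncSeq_shortExact b)
      (ih (b + 1) (by push_cast at hb; omega) (by omega))
      (truncSeq_X₃_extTrivialVanishes hA hN b hb'.ne)

end Truncation

end GrMod

namespace GrMod

section Resolution

variable {k : Type w} [Field k] {A : Type u} [Ring A] [Algebra k A] {𝒜 : ℕ → Submodule k A}
  [GradedAlgebra 𝒜]

/-! ### Resolutions from vanishing of extension groups -/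

/-- One step of a minimal projective resolution. -/
theorem exists_syzygy (h : IsStandardlyGraded 𝒜) {D : ℕ → Set ℤ} (hD : ∀ m, (D m).Finite)
    (N : GrMod 𝒜) [Module.Finite A N] (hN : ∀ m, ∀ j ∉ D m, N.ExtTrivialVanishes m j) :
    ∃ (K Q : GrMod 𝒜) (f : K ⟶ Q) (g : Q ⟶ N) (w : f ≫ g = 0),
      (ShortComplex.mk f g w).ShortExact ∧ Projective Q ∧ Module.Finite A Q ∧
      Q.GeneratedInDegrees (D 0) ∧ Module.Finite A K ∧
      ∀ m, ∀ j ∉ D (m + 1), K.ExtTrivialVanishes m j := by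
  obtain ⟨r, ⟨E⟩⟩ := h.exists_splitIdempotents
  obtain ⟨Q, g, hQ, hfin, hg, hker⟩ := exists_projective_cover E N
  have hS := kernelSeq_shortExact hg
  obtain ⟨⟨a, ha⟩, hlf⟩ := bounded_locallyFinite_of_finite h Q
  have hK : ∀ m, ∀ j ∉ D (m + 1), (kernelSeq g).X₁.ExtTrivialVanishes m j := by
    intro m j hj
    cases m with
    -- Vanishing of `Ext¹(N, Λ₀[j])` extends `u` to the cover `Q`, and the extension is zero on the
    -- kernel by minimality.
    | zero =>
      refine Abelian.Ext.subsingleton_zero_iff.2 fun u => ?_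
      obtain ⟨v, rfl⟩ := Abelian.Ext.exists_extension hS (hN 1 j hj) u
      exact hker j v
    | succ m =>
      exact Abelian.Ext.subsingleton_X₁ hS (Abelian.Ext.subsingleton_of_projective Q _ _)
        (hN (m + 2) j hj)
  refine ⟨_, Q, (kernelSeq g).f, g, (kernelSeq g).zero, hS, hQ, hfin, ?_, ?_, hK⟩
  -- A morphism from `Q` to `Λ₀[j]` kills the kernel, so it factors through `N`, where it is zero
  -- for `j ∉ D 0`.
  · refine generatedInDegrees_of_hom_eq_zero E ha fun j hj u => ?_
    have := hS.epi_g
    obtain ⟨v, hv⟩ : ∃ v : N ⟶ (trivialMod 𝒜).shift j, g ≫ v = u :=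
      ⟨hS.exact.desc u (hker j u), hS.exact.g_desc u (hker j u)⟩
    rw [← hv, Abelian.Ext.subsingleton_zero_iff.1 (hN 0 j hj) v, comp_zero]
  · exact (generatedInDegrees_of_hom_eq_zero E
      (IsGE.of_injective ha (kernelSeq g).f Subtype.val_injective) fun j hj =>
        Abelian.Ext.subsingleton_zero_iff.1 (hK 0 j hj)).finite (hD 1) fun j =>
      finite_gr_of_injective (kernelSeq g).f Subtype.val_injective (hlf j)

theorem hasResolutionInDegrees_of_extTrivialVanishes (h : IsStandardlyGraded 𝒜) {D : ℕ → Set ℤ}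
    (hD : ∀ m, (D m).Finite) (N : GrMod 𝒜) [hfin : Module.Finite A N]
    (hN : ∀ m, ∀ j ∉ D m, N.ExtTrivialVanishes m j) : N.HasResolutionInDegrees D := by
  -- The `i`-th syzygy satisfies the vanishing condition for the sequence `D` shifted by `i`. This
  -- is the invariant of the recursive construction.
  let P : ℕ → GrMod 𝒜 → Prop := fun i N => Module.Finite A N ∧
    ∀ m, ∀ j ∉ D (m + i), N.ExtTrivialVanishes m j
  have step : ∀ (i : ℕ) (N : {N // P i N}), ∃ (K : {K // P (i + 1) K}) (Q : GrMod 𝒜)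
      (f : K.1 ⟶ Q) (g : Q ⟶ N.1) (w : f ≫ g = 0), (ShortComplex.mk f g w).ShortExact ∧
      Projective Q ∧ Module.Finite A Q ∧ Q.GeneratedInDegrees (D i) := by
    rintro i ⟨N, hN, hN'⟩
    obtain ⟨K, Q, f, g, w, hS, hQ, hQf, hQg, hK, hK'⟩ :=
      exists_syzygy h (D := fun m => D (m + i)) (fun m => hD _) N hN'
    refine ⟨⟨K, hK, fun m j hj => hK' m j ?_⟩, Q, f, g, w, hS, hQ, hQf, by simpa using hQg⟩
    rwa [add_right_comm m 1 i]
  choose K Q f g w hS hQ hQf hQg using step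
  let S : ∀ i, {N // P i N} := fun i => Nat.rec ⟨N, hfin, hN⟩ (fun i N => K i N) i
  obtain ⟨R, hR⟩ := exists_projectiveResolution_of_syzygies (fun i => (S i).1) (fun i => Q i (S i))
    (fun i => f i (S i)) (fun i => g i (S i)) (fun i => w i (S i)) (fun i => hS i (S i))
    (fun i => hQ i (S i))
  refine ⟨R, fun i => ?_⟩
  rw [hR i]
  exact ⟨hQf i (S i), hQg i (S i)⟩

end Resolution

section Radical

variable {k : Type w} [Field k] {A : Type u} [Ring A] [Algebra k A] {𝒜 : ℕ → Submodule k A}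
  [GradedAlgebra 𝒜]

/-! ### Powers of the radical of a module generated in degree `0` -/

/-- Standard grading gives `Λ_j = Λ_{j-i} Λ_i`, and `Λ_i` is the `i`-fold product of `Λ_1 ⊆ J`. -/
theorem component_le_irrelevant_pow (h : IsStandardlyGraded 𝒜) {i j : ℕ} (hij : i ≤ j) {a : A}
    (ha : a ∈ 𝒜 j) : a ∈ (HomogeneousIdeal.irrelevant 𝒜).toIdeal ^ i := by
  set J := (HomogeneousIdeal.irrelevant 𝒜).toIdeal
  have h1 : ∀ i : ℕ, ∀ a ∈ 𝒜 i, a ∈ J ^ i := by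
    intro i
    induction i with
    | zero =>
      intro a _
      rw [Submodule.pow_zero, Ideal.one_eq_top]
      trivial
    | succ n ih =>
      intro a ha
      have hJ : ∀ a ∈ 𝒜 1, a ∈ J := fun a ha =>
        HomogeneousIdeal.mem_irrelevant_of_mem 𝒜 one_pos ha
      rcases eq_or_ne n 0 with rfl | hn
      · rw [zero_add, Submodule.pow_one]
        exact hJ a ha
      · rw [Submodule.pow_succ' _ hn]
        rw [add_comm, ← h.mul_eq] at ha
        exact Submodule.mul_induction_on ha
          (fun x hx y hy => Ideal.mul_mem_mul (hJ x hx) (ih y hy)) fun x y => add_mem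
  have hj : j = (j - i) + i := by omega
  rw [hj, ← h.mul_eq] at ha
  exact Submodule.mul_induction_on ha
    (fun x _ y hy => Ideal.mul_mem_left _ x (h1 i y hy)) fun x y => add_mem

theorem smul_mem_geSub {M : GrMod 𝒜} {b : ℤ} {a : A}
    (ha : a ∈ (HomogeneousIdeal.irrelevant 𝒜).toIdeal) {x : M} (hx : x ∈ M.geSub b) :
    a • x ∈ M.geSub (b + 1) := by
  have ha' : a ∈ (HomogeneousIdeal.irrelevant 𝒜).toAddSubmonoid := ha
  rw [HomogeneousIdeal.irrelevant_eq_closure] at ha'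
  refine AddSubmonoid.closure_induction (fun c hc => ?_) ?_ (fun c e _ _ hc he => ?_) ha'
  · obtain ⟨n, hn, hc⟩ := Set.mem_iUnion₂.1 hc
    intro j hj
    rw [proj_smul M hc, hx _ (by omega), smul_zero]
  · rw [zero_smul]
    exact zero_mem _
  · rw [add_smul]
    exact add_mem hc he

/-- `J` raises degrees by at least one, so `J^i M ⊆ M_{≥ i}`. Conversely `M_j = Λ_j M_0` and `Λ_j ⊆
J^i` for `j ≥ i`. -/
theorem irrelevant_pow_smul_eq_geSub (h : IsStandardlyGraded 𝒜) {M : GrMod 𝒜}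
    (hM : M.GeneratedInDegrees {0}) (i : ℕ) :
    (HomogeneousIdeal.irrelevant 𝒜).toIdeal ^ i • (⊤ : Submodule A M) = M.geSub i := by
  set J := (HomogeneousIdeal.irrelevant 𝒜).toIdeal
  have hgen : Submodule.span A (M.gr 0 : Set M) = ⊤ := by
    simpa [GeneratedInDegrees] using hM
  apply le_antisymm
  · induction i with
    | zero =>
      rw [Submodule.pow_zero, Ideal.one_eq_top, Submodule.top_smul, ← hgen, Submodule.span_le]
      exact fun x hx => mem_geSub_of_le (by simp) hx
    | succ n ih =>
      have h1 : J • M.geSub n ≤ M.geSub (n + 1 : ℕ) := Submodule.smul_le.2 fun a ha x hx => by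
        push_cast
        exact smul_mem_geSub ha hx
      rcases eq_or_ne n 0 with rfl | hn
      · rw [zero_add, Submodule.pow_one]
        refine le_trans (Submodule.smul_mono le_rfl ?_) h1
        rwa [Submodule.pow_zero, Ideal.one_eq_top, Submodule.top_smul] at ih
      · rw [Submodule.pow_succ' _ hn, Submodule.mul_smul]
        exact (Submodule.smul_mono le_rfl ih).trans h1
  -- The extra factor `a` makes the span induction close under scalar multiplication; it is set to
  -- `1` at the end.
  · have key : ∀ j : ℤ, (i : ℤ) ≤ j → ∀ x, ∀ a : A,
        M.proj j (a • x) ∈ J ^ i • (⊤ : Submodule A M) := by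
      intro j hj x
      have hx : x ∈ Submodule.span A (M.gr 0 : Set M) := hgen ▸ trivial
      induction hx using Submodule.span_induction with
      | mem x hx =>
        intro a
        refine DirectSum.Decomposition.inductionOn 𝒜
          (motive := fun a => M.proj j (a • x) ∈ J ^ i • (⊤ : Submodule A M)) ?_
          (fun {n} a => ?_) (fun a b ha hb => ?_) a
        · rw [zero_smul, map_zero]
          exact zero_mem _
        · rw [proj_smul M a.2]
          by_cases hn : j = n
          · exact Submodule.smul_mem_smul
              (component_le_irrelevant_pow h (by omega : i ≤ n) a.2) trivial
          · rw [proj_ne (by omega : (0 : ℤ) ≠ j - n) hx, smul_zero]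
            exact zero_mem _
        · rw [add_smul, map_add]
          exact add_mem ha hb
      | zero =>
        intro a
        rw [smul_zero, map_zero]
        exact zero_mem _
      | add x y _ _ hx hy =>
        intro a
        rw [smul_add, map_add]
        exact add_mem (hx a) (hy a)
      | smul b x _ hx =>
        intro a
        rw [smul_smul]
        exact hx (a * b)
    intro x hx
    have h1 := mem_span_gradedProj M.isInternal x
    refine (Submodule.span_le (p := (J ^ i • (⊤ : Submodule A M)).restrictScalars k)).2 ?_ h1
    rintro _ ⟨j, rfl⟩
    by_cases hj : (i : ℤ) ≤ j
    · rw [← one_smul A x]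
      exact key j hj x 1
    · have : M.proj j x = 0 := hx j (by omega)
      change M.proj j x ∈ _
      rw [this]
      exact zero_mem _

theorem radPow_eq_trunc (h : IsStandardlyGraded 𝒜) {M : GrMod 𝒜}
    (hM : M.GeneratedInDegrees {0}) (i : ℕ) : M.radPow i = M.trunc i := by
  unfold radPow trunc
  congr 1
  exact irrelevant_pow_smul_eq_geSub h hM i

end Radical

section Main

variable {k : Type w} [Field k] {A : Type u} [Ring A] [Algebra k A] {𝒜 : ℕ → Submodule k A}
  [GradedAlgebra 𝒜]

/-! ### Radical powers of generalized `d`-Koszul modules -/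

theorem delta_even (d n : ℕ) : delta d (2 * n) = n * d := by
  simp [delta]

theorem delta_odd (d n : ℕ) : delta d (2 * n + 1) = n * d + 1 := by
  have : (2 * n + 1) / 2 = n := by omega
  simp [delta, this]

theorem mem_Delta_even {d n : ℕ} {j : ℤ} : j ∈ Delta d (2 * n) ↔ j = n * d := by
  simp [Delta]

theorem mem_Delta_odd {d n : ℕ} {j : ℤ} :
    j ∈ Delta d (2 * n + 1) ↔ n * d + 1 ≤ j ∧ j ≤ n * d + d - 1 := by
  have : (2 * n + 1) / 2 = n := by omega
  simp [Delta, this]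

theorem Delta_finite (d m : ℕ) : (Delta d m).Finite := by
  unfold Delta
  split_ifs
  · exact Set.finite_singleton _
  · exact Set.finite_Icc _ _

/-- Shifting `Δ(m)` by one beyond the minimal degree avoids both `Δ(m)` and `δ(m + 1)`. -/
theorem not_mem_Delta_succ {d m : ℕ} {j : ℤ} (h1 : delta d m ≤ j) (h2 : j ∉ Delta d m) :
    j + 1 ∉ Delta d m ∧ j + 1 ≠ delta d (m + 1) := by
  obtain ⟨n, rfl | rfl⟩ := Nat.even_or_odd' m
  · rw [delta_even] at h1
    rw [mem_Delta_even] at h2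
    rw [mem_Delta_even, delta_odd]
    omega
  · rw [delta_odd] at h1
    rw [mem_Delta_odd] at h2
    rw [mem_Delta_odd, show 2 * n + 1 + 1 = 2 * (n + 1) by ring, delta_even]
    push_cast
    rw [add_mul, one_mul]
    omega

theorem trunc_extTrivialVanishes_of_generalizedDKoszul {d : ℕ} (hA : IsDKoszulAlgebra 𝒜 d)
    {M : GrMod 𝒜} (hlf : M.IsLocallyFinite) (hge : M.geSub 0 = ⊤)
    (hM : ∀ m, ∀ j ∉ Delta d m, M.ExtTrivialVanishes m j) (i m : ℕ) {j : ℤ}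
    (hj : j - i ∉ Delta d m) : (M.trunc i).ExtTrivialVanishes m j := by
  induction i generalizing m j with
  | zero =>
    let e : M.trunc (0 : ℕ) ≅ M :=
      { hom := subι M _ _
        inv := ofLin (M := M) (N := M.trunc (0 : ℕ)) (LinearMap.codRestrict (M.geSub 0) LinearMap.id
          fun x => hge ▸ trivial) fun _ _ hm => hm
        hom_inv_id := rfl
        inv_hom_id := rfl }
    exact Abelian.Ext.subsingleton_of_iso e (hM m j (by simpa using hj))
  | succ i ih =>
    push_cast at hj ⊢
    -- Below `i + 1 + δ(m)` the general bound applies. From there on, `j - i` avoids both `Δ(m)` and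
    -- `δ(m + 1)`, so both neighbours in the long exact sequence vanish.
    by_cases hlt : j < (i + 1 : ℤ) + delta d m
    · exact trunc_extTrivialVanishes hA hlf hlt
    obtain ⟨h1, h2⟩ := not_mem_Delta_succ (by omega) hj
    rw [show j - (i + 1 : ℤ) + 1 = j - i by ring] at h1 h2
    exact Abelian.Ext.subsingleton_X₁ (M.truncSeq_shortExact i) (ih m h1)
      (truncSeq_X₃_extTrivialVanishes hA hlf i (by omega))

end Main

end GrMod

/-! ### Deduction of the two assertions -/

open GrMod in
theorem theorem2p6 {k : Type w} [Field k] {A : Type u} [Ring A] [Algebra k A]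
    (𝒜 : ℕ → Submodule k A) [GradedAlgebra 𝒜] (d : ℕ) (hd : 2 ≤ d)
    (hA : IsDKoszulAlgebra 𝒜 d) (M : GrMod 𝒜) (hM : M.IsGeneralizedDKoszul d) :
    (∀ i : ℕ, 1 ≤ i → ((M.radPow i).shift (-(i : ℤ))).IsGeneralizedDKoszul d) ∧
    (∀ n : ℕ, 1 ≤ n → ∀ s ∈ Set.Icc 1 (d - 1), ∀ t ∈ Set.Icc 1 (d - 1),
      Nonempty
        (Abelian.Ext (M.radPow s) ((GrMod.trivialMod 𝒜).shift ((n : ℤ) * (d : ℤ))) (2 * n - 1)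
          ≃ₗ[k]
        Abelian.Ext (M.radPow t) ((GrMod.trivialMod 𝒜).shift ((n : ℤ) * (d : ℤ)))
          (2 * n - 1))) := by
  have hfin := HasResolutionInDegrees.finite hM
  have hM' : ∀ m, ∀ j ∉ Delta d m, M.ExtTrivialVanishes m j :=
    fun m j hj => HasResolutionInDegrees.extTrivialVanishes hM hj
  obtain ⟨r, ⟨E⟩⟩ := hA.isStandardlyGraded.exists_splitIdempotents
  obtain ⟨⟨a, ha⟩, hlf⟩ := bounded_locallyFinite_of_finite hA.isStandardlyGraded M
  have hgen : M.GeneratedInDegrees {0} := generatedInDegrees_of_hom_eq_zero E ha fun j hj =>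
    Abelian.Ext.subsingleton_zero_iff.1 (hM' 0 j (by simpa [Delta] using hj))
  have hge : M.geSub 0 = ⊤ := by
    have := irrelevant_pow_smul_eq_geSub hA.isStandardlyGraded hgen 0
    rw [Submodule.pow_zero, Ideal.one_eq_top, Submodule.top_smul] at this
    exact this.symm
  simp only [radPow_eq_trunc hA.isStandardlyGraded hgen]
  have hvan := trunc_extTrivialVanishes_of_generalizedDKoszul hA hlf hge hM'
  refine ⟨fun i _ => ?_, fun n hn => ?_⟩
  -- In homological degree `0` the vanishing says that `M_{≥ i}` is generated in the single degree
  -- `i`, whose component is finite-dimensional.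
  · have hfin' : Module.Finite A ((M.trunc i).shift (-(i : ℤ))) :=
      (generatedInDegrees_of_hom_eq_zero (D := {(i : ℤ)}) E (M.trunc_isGE i) fun j hj =>
        Abelian.Ext.subsingleton_zero_iff.1 (hvan i 0 (by
          simpa [Delta, sub_eq_zero] using hj))).finite (Set.finite_singleton _) (hlf.trunc i)
    refine hasResolutionInDegrees_of_extTrivialVanishes hA.isStandardlyGraded (Delta_finite d) _
      fun m j hj => ?_
    have := (hvan i m (j := j + i) (by rwa [add_sub_cancel_right])).shift (-(i : ℤ))
    rwa [add_neg_cancel_right] at this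
  · obtain ⟨n, rfl⟩ := Nat.exists_eq_add_of_le' hn
    rw [show 2 * (n + 1) - 1 = 2 * n + 1 by omega]
    have key : ∀ s : ℕ, s + 1 ≤ d - 1 → Nonempty
        (Abelian.Ext (M.trunc (1 : ℕ))
          ((GrMod.trivialMod 𝒜).shift (((n + 1 : ℕ) : ℤ) * (d : ℤ))) (2 * n + 1) ≃ₗ[k]
        Abelian.Ext (M.trunc (s + 1 : ℕ))
          ((GrMod.trivialMod 𝒜).shift (((n + 1 : ℕ) : ℤ) * (d : ℤ))) (2 * n + 1)) := by
      intro s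
      induction s with
      | zero => exact fun _ => ⟨LinearEquiv.refl _ _⟩
      | succ s ih =>
        intro hs
        obtain ⟨e⟩ := ih (by omega)
        -- The layer is `M_{s+1}`, and the exponent is `n + 1`. Vanishing needs `(n+1)d ≠ (s+1) + nd
        -- + 1`, which follows from `s + 2 ≤ d - 1`, and `(n+1)d ≠ (s+1) + (n+1)d`, which follows
        -- from `s + 1 > 0`.
        obtain ⟨e'⟩ := Abelian.Ext.nonempty_linearEquiv_of_subsingleton k
          (M.truncSeq_shortExact (s + 1 : ℕ))
          (Y := (GrMod.trivialMod 𝒜).shift (((n + 1 : ℕ) : ℤ) * (d : ℤ))) (n := 2 * n + 1)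
          (truncSeq_X₃_extTrivialVanishes hA hlf _ (by
            rw [delta_odd]; push_cast; rw [add_mul, one_mul]; omega))
          (truncSeq_X₃_extTrivialVanishes hA hlf _ (by
            rw [show 2 * n + 1 + 1 = 2 * (n + 1) by ring, delta_even]; push_cast; omega))
        exact ⟨e.trans e'⟩
    rintro s ⟨hs1, hs⟩ t ⟨ht1, ht⟩
    obtain ⟨s, rfl⟩ := Nat.exists_eq_add_of_le' hs1
    obtain ⟨t, rfl⟩ := Nat.exists_eq_add_of_le' ht1
    obtain ⟨e⟩ := key s hs
    obtain ⟨e'⟩ := key t ht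
    rw [radPow_eq_trunc hA.isStandardlyGraded hgen, radPow_eq_trunc hA.isStandardlyGraded hgen]
    exact ⟨e.symm.trans e'⟩
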